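/- Let $G$ be a second countable locally compact (Hausdorff) group, with left Haar measure $\lambda$. Let $Y$ be a standard Borel space with a Borel action of $G$ and a non-zero finite $G$-invariant measure $\nu$ which is ergodic: every $G$-invariant Borel subset of $Y$ is $\nu$-null or $\nu$-conull. Property $T$ of the action. A Hilbert bundle $\mathcal H=(\mathcal H(y))_{y\in Y}$ over $Y$ is a measurable field of complex Hilbert spaces, given by a fundamental sequence of sections $(\xi_n)$ such that the functions $y\mapsto\langle \xi_m(y),\xi_n(y)\rangle$ are Borel and, for every $y$, the vectors $\xi_n(y)$ span a dense subspace of $\mathcal H(y)$; a section $\xi$ is Borel if all the functions $y\mapsto\langle\xi_n(y),\xi(y)\rangle$ are. A representation of the action in $\mathcal H$ is a Borel family of operators $L(y,g):\mathcal H(g^{-1}y)\to\mathcal H(y)$ (that is, all the functions $(y,g)\mapsto\langle\xi_m(y),L(y,g)\xi_n(g^{-1}y)\rangle$ are Borel on $Y\times G$) such that, for some conull Borel set $U\subset Y$, $L(y,g)$ is a Hilbert space isomorphism whenever $y,g^{-1}y\in U$, $L(y,e)=\mathrm{Id}$ for $y\in U$, and $L(y,gh)=L(y,g)L(g^{-1}y,h)$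 whenever $y,\,g^{-1}y,\,(gh)^{-1}y\in U$. A unit section is a Borel section $\xi$ with $\|\xi(y)\|=1$ for $\nu$-almost every $y$. The action has property $T$ if every representation $L$ for which there is a sequence of unit sections $(\xi_n)$ with $\|\xi_n(y)-L(y,g)\xi_n(g^{-1}y)\|\to 0$ for $\nu\times\lambda$-almost every $(y,g)$ has an invariant unit section, that is, a unit section $\xi$ with $\xi(y)=L(y,g)\xi(g^{-1}y)$ for $\nu\times\lambda$-almost every $(y,g)$. The group $G$ has (Kazhdan's) property $T$ if every strongly continuous unitary representation $\pi$ of $G$ on a separable complex Hilbert space for which there is a sequence of unit vectors $(\xi_n)$ with $\|\pi(g)\xi_n-\xi_n\|\to 0$ uniformly on compact subsets of $G$ has an invariant unit vector. Then: (i) if $G$ has property $T$, so does the $G$-action on $(Y,\nu)$; (ii) if $G$ is a countable discrete group and the $G$-action on $(Y,\nu)$ has property $T$, then $G$ has property $T$. -/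

import Mathlib

open MeasureTheory Filter Topology

/-- A (complex, separable) Hilbert bundle over a Borel space `Y`: a family of Hilbert spaces with a
fundamental sequence of sections. The Borel structure of the total space is the one generated by
the projection to `Y` and the functions `(y, v) ↦ ⟪fund n y, v⟫`. The fibres may vary with `y`
(in dimension too); condition `separates` makes each of them separable, so that fibres in `Type`
exhaust all possibilities up to isomorphism. -/
structure HilbertBundle (Y : Type*) [MeasurableSpace Y] where
  /-- the Hilbert space over a point -/
  fiber : Y → Type
  [normed : ∀ y, NormedAddCommGroup (fiber y)]
  [innerProduct : ∀ y, InnerProductSpace ℂ (fiber y)]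
  [complete : ∀ y, CompleteSpace (fiber y)]
  /-- the fundamental sequence of sections -/
  fund : ℕ → ∀ y, fiber y
  measurable_inner : ∀ m n, Measurable fun y => inner ℂ (fund m y) (fund n y)
  separates : ∀ (y : Y) (v : fiber y), (∀ n, inner ℂ (fund n y) v = 0) → v = 0

attribute [instance] HilbertBundle.normed HilbertBundle.innerProduct HilbertBundle.complete

/-- A section is Borel, as a map into the total space, iff its coefficients with respect to the
fundamental sequence are Borel. -/
def HilbertBundle.IsBorelSection {Y : Type*} [MeasurableSpace Y] (H : HilbertBundle Y)
    (s : ∀ y, H.fiber y) : Prop :=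
  ∀ n, Measurable fun y => inner ℂ (H.fund n y) (s y)

/-- A unit section: a Borel section of norm one almost everywhere. -/
def HilbertBundle.IsUnitSection {Y : Type*} [MeasurableSpace Y] (H : HilbertBundle Y)
    (ν : Measure Y) (s : ∀ y, H.fiber y) : Prop :=
  H.IsBorelSection s ∧ ∀ᵐ y ∂ν, ‖s y‖ = 1

/-- A representation, in the Hilbert bundle `H`, of the measured groupoid `Y ⋊ G` of an action of
`G` on `(Y, ν)`. The groupoid is `Y × G`, with range `r (x, g) = x`, source `s (x, g) = g⁻¹ • x`
and product `(x, g) (g⁻¹ • x, h) = (x, g * h)`. The operator of the element `(x, g)` goes from the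
fibre over its source `y` to the fibre over its range `x`. The operators form a Borel family and,
on the reduction of the groupoid to a conull Borel set `U` of units, they form a strict
representation by Hilbert space isomorphisms (they are onto there by `one` and `mul`, the clauses
on units and products). Their values off that reduction are irrelevant. -/
structure GroupoidRep (G : Type*) {Y : Type*} [Group G] [MeasurableSpace G] [MeasurableSpace Y]
    [MulAction G Y] (ν : Measure Y) (H : HilbertBundle Y) where
  /-- the operator of the groupoid element `(x, g)` with source `y` -/
  op : ∀ (x : Y) (g : G) (y : Y), y = g⁻¹ • x → (H.fiber y →L[ℂ] H.fiber x)
  measurable_op : ∀ m n, Measurable fun p : Y × G =>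
    inner ℂ (H.fund m p.1) (op p.1 p.2 (p.2⁻¹ • p.1) rfl (H.fund n (p.2⁻¹ • p.1)))
  /-- the conull set of units over which the representation is strict -/
  U : Set Y
  measurableSet_U : MeasurableSet U
  conull_U : ν Uᶜ = 0
  isometry : ∀ (x : Y) (g : G) (y : Y) (h : y = g⁻¹ • x), x ∈ U → y ∈ U →
    ∀ v : H.fiber y, ‖op x g y h v‖ = ‖v‖
  one : ∀ (x : Y) (h : x = (1 : G)⁻¹ • x), x ∈ U → ∀ v : H.fiber x, op x 1 x h v = v
  mul : ∀ (x : Y) (g : G) (y : Y) (k : G) (z : Y) (hy : y = g⁻¹ • x) (hz : z = k⁻¹ • y)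
    (hz' : z = (g * k)⁻¹ • x), x ∈ U → y ∈ U → z ∈ U →
    ∀ v : H.fiber z, op x (g * k) z hz' v = op x g y hy (op y k z hz v)

section

variable {G Y : Type*} [Group G] [MeasurableSpace G] [MeasurableSpace Y] [MulAction G Y]
  {ν : Measure Y} {H : HilbertBundle Y}

/-- The norm of the coboundary of a section `s` at the groupoid element `p = (x, g)`:
`‖s x - L (x, g) (s (g⁻¹ • x))‖`. -/
noncomputable def GroupoidRep.coboundaryNorm (L : GroupoidRep G ν H) (s : ∀ y, H.fiber y)
    (p : Y × G) : ℝ :=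
  ‖s p.1 - L.op p.1 p.2 (p.2⁻¹ • p.1) rfl (s (p.2⁻¹ • p.1))‖

variable [TopologicalSpace G] [IsTopologicalGroup G] [LocallyCompactSpace G] [BorelSpace G]

/-- The representation has an invariant unit section: `s x = L (x, g) (s (g⁻¹ • x))` for almost all
`(x, g)`, with respect to the product of `ν` and the Haar measure. -/
def GroupoidRep.HasInvariantUnitSection (L : GroupoidRep G ν H) : Prop :=
  ∃ s : ∀ y, H.fiber y, H.IsUnitSection ν s ∧
    ∀ᵐ p ∂(ν.prod (Measure.haar : Measure G)),
      s p.1 = L.op p.1 p.2 (p.2⁻¹ • p.1) rfl (s (p.2⁻¹ • p.1))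

/-- The representation almost contains unit invariant sections: there is a sequence of unit
sections whose coboundaries tend to zero almost everywhere. -/
def GroupoidRep.AlmostHasInvariantUnitSections (L : GroupoidRep G ν H) : Prop :=
  ∃ s : ℕ → ∀ y, H.fiber y, (∀ n, H.IsUnitSection ν (s n)) ∧
    ∀ᵐ p ∂(ν.prod (Measure.haar : Measure G)),
      Tendsto (fun n => L.coboundaryNorm (s n) p) atTop (𝓝 0)

end

/-- The action of the locally compact group `G` on `(Y, ν)` has property T. -/
def ActionHasPropertyT (G : Type*) {Y : Type*} [Group G] [TopologicalSpace G]
    [IsTopologicalGroup G] [LocallyCompactSpace G] [MeasurableSpace G] [BorelSpace G]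
    [MeasurableSpace Y] [MulAction G Y] (ν : Measure Y) : Prop :=
  ∀ (H : HilbertBundle Y) (L : GroupoidRep G ν H),
    L.AlmostHasInvariantUnitSections → L.HasInvariantUnitSection

/-- Kazhdan's property T for a (second countable locally compact) topological group: every strongly
continuous unitary representation on a separable complex Hilbert space which has a sequence of unit
vectors that are asymptotically invariant, uniformly on compact sets, has an invariant unit
vector. -/
def IsKazhdanGroup (G : Type*) [Group G] [TopologicalSpace G] : Prop :=
  ∀ (K : Type) [NormedAddCommGroup K] [InnerProductSpace ℂ K] [CompleteSpace K]
    [TopologicalSpace.SeparableSpace K] (π : G →* (K ≃ₗᵢ[ℂ] K)),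
    (∀ v : K, Continuous fun g => π g v) →
    (∃ ξ : ℕ → K, (∀ n, ‖ξ n‖ = 1) ∧ ∀ Q : Set G, IsCompact Q →
      TendstoUniformlyOn (fun n g => ‖π g (ξ n) - ξ n‖) (fun _ => 0) atTop Q) →
    ∃ v : K, ‖v‖ = 1 ∧ ∀ g, π g v = v

/-! For (i), Gram–Schmidt applied to the fundamental sequence embeds the fibres measurably and
isometrically in one space `ℓ²`. Sections become `ℓ²`-valued functions, and since `ν` is invariant,
the representation integrates to operators `lpOp g` on `L²(Y, ℓ²)`. The embeddings need not be onto,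
so these operators are only contractions: `lpOp 1` projects onto the square integrable sections, and
the group acts unitarily on its range. As `ν` is finite, unit sections are vectors of constant norm
there, and dominated convergence makes them asymptotically invariant for almost every `g`.
Steinhaus' theorem upgrades measurability to strong continuity
(`continuous_of_measurable_of_contraction`) and almost everywhere convergence to uniform convergence
on compact sets (`tendstoUniformlyOn_of_ae_tendsto`). Kazhdan's property then gives a fixed nonzero
section. The set where it does not vanish is almost invariant, hence conull by ergodicity
(`ae_or_ae_of_forall_ae_smul_mem_iff`), and normalizing gives the invariant unit section.

For (ii), suppose that `π` has almost invariant unit vectors but no invariant one. Then it yields an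
isometric orbit `b` that is unbounded (`exists_unbounded_orbit`). By Schoenberg, the kernels `exp
(-‖b g - b h‖² / (k + 1))` are positive semidefinite. The direct sum over `k` of the representations
they define has almost invariant vectors, since the kernels tend to one as `k` grows; yet it tends
weakly to zero along any sequence on which `b` escapes to infinity
(`exists_almost_invariant_weakly_mixing`). In the constant bundle, property T of the action would
give an invariant unit section `s`. Up to small measure, `s` takes values near a finite set, and `ν`
is finite and invariant, so `s y = σ (γ n) (s ((γ n)⁻¹ • y))` contradicts weak convergence to zero
(`not_ae_invariant_of_tendsto_inner_zero`). -/

/-- An orthonormal family in a separable space is countable. -/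
theorem Orthonormal.countable_of_separableSpace {ι E : Type*} [NormedAddCommGroup E]
    [InnerProductSpace ℂ E] [TopologicalSpace.SeparableSpace E] {b : ι → E}
    (hb : Orthonormal ℂ b) : Countable ι := by
  refine Pairwise.countable_of_isOpen_disjoint (s := fun i => Metric.ball (b i) (1 / 2)) ?_
    (fun _ => Metric.isOpen_ball) (fun i => Metric.nonempty_ball.2 (by norm_num))
  intro i j hij
  refine Metric.ball_disjoint_ball ?_
  have h : ‖b i - b j‖ ^ 2 = 2 := by
    have := @norm_sub_sq ℂ E _ _ _ (b i) (b j)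
    rw [this, hb.1 i, hb.1 j, hb.2 hij]
    norm_num
  rw [dist_eq_norm]
  nlinarith [norm_nonneg (b i - b j)]

/-- A separable Hilbert space in any universe is isometric to some `ℓ²` space in `Type`. -/
theorem exists_linearIsometryEquiv_lp (E : Type*) [NormedAddCommGroup E] [InnerProductSpace ℂ E]
    [CompleteSpace E] [TopologicalSpace.SeparableSpace E] :
    ∃ ι : Type, Nonempty (E ≃ₗᵢ[ℂ] lp (fun _ : ι => ℂ) 2) := by
  obtain ⟨w, b, -⟩ := exists_hilbertBasis ℂ E
  have : Countable w := b.orthonormal.countable_of_separableSpace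
  obtain ⟨f, hf⟩ := exists_injective_nat w
  -- A subset of `ℕ` is an index set in `Type`, the only universe over which `IsKazhdanGroup`
  -- quantifies.
  let e : w ≃ Set.range f := Equiv.ofInjective f hf
  refine ⟨Set.range f, ⟨(HilbertBasis.mk (v := b ∘ e.symm)
    (b.orthonormal.comp _ e.symm.injective) ?_).repr⟩⟩
  rw [e.symm.surjective.range_comp, b.dense_span]

/-! ### Kazhdan's property for measurable families of contractions -/

section

variable {G E : Type*} [Group G] [NormedAddCommGroup E] [InnerProductSpace ℂ E]

/-- A multiplicative family of contractions acts on the range of the projection `T 1` by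
surjective isometries. -/
theorem exists_monoidHom_of_contraction (T : G → E →L[ℂ] E)
    (hmul : ∀ g h v, T (g * h) v = T g (T h v)) (hT : ∀ g v, ‖T g v‖ ≤ ‖v‖) :
    ∃ F : Submodule ℂ E, (∀ v, v ∈ F ↔ T 1 v = v) ∧ ∃ π : G →* (F ≃ₗᵢ[ℂ] F),
      ∀ g v, (π g v : E) = T g v := by
  -- Each `T g` maps into the fixed space of `T 1`, where `T g⁻¹` inverts it; a contraction whose
  -- inverse is a contraction is isometric.
  let F := LinearMap.eqLocus (T 1 : E →ₗ[ℂ] E) LinearMap.id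
  have hmem : ∀ g v, T g v ∈ F := fun g v => by
    change T 1 (T g v) = T g v
    rw [← hmul, one_mul]
  have hfix : ∀ v : F, T 1 (v : E) = v := fun v => v.2
  have hinv : ∀ g (v : F), T g⁻¹ (T g (v : E)) = v := fun g v => by
    rw [← hmul, inv_mul_cancel, hfix]
  let ρ : G → (F →ₗ[ℂ] F) := fun g => ((T g : E →ₗ[ℂ] E).comp F.subtype).codRestrict F
    (fun v => hmem g v)
  have hρ : ∀ g (v : F), (ρ g v : E) = T g v := fun g v => rfl
  let e : G → (F ≃ₗ[ℂ] F) := fun g => LinearEquiv.ofLinearMap (ρ g) (ρ g⁻¹)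
    (by ext v; simpa [hρ] using hinv g⁻¹ v) (by ext v; simpa [hρ] using hinv g v)
  refine ⟨F, fun v => Iff.rfl, MonoidHom.mk' (fun g => ⟨e g, fun v => le_antisymm (hT g v) ?_⟩) ?_, fun g v => rfl⟩
  · calc ‖v‖ = ‖T g⁻¹ (T g (v : E))‖ := by rw [hinv]; rfl
      _ ≤ ‖T g (v : E)‖ := hT _ _
  · intro g h
    ext v
    exact hmul g h v

variable [TopologicalSpace G]

/-- Kazhdan's property for a strongly continuous multiplicative family of contractions of a
separable Hilbert space in any universe. -/
theorem IsKazhdanGroup.exists_fixed_of_continuous (hG : IsKazhdanGroup G) [CompleteSpace E]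
    [TopologicalSpace.SeparableSpace E] (T : G → E →L[ℂ] E)
    (hmul : ∀ g h v, T (g * h) v = T g (T h v)) (hT : ∀ g v, ‖T g v‖ ≤ ‖v‖)
    (hcont : ∀ v, Continuous fun g => T g v) (ξ : ℕ → E) (hξ : ∀ n, ‖ξ n‖ = 1)
    (hξ1 : ∀ n, T 1 (ξ n) = ξ n)
    (hlim : ∀ Q : Set G, IsCompact Q →
      TendstoUniformlyOn (fun n g => ‖T g (ξ n) - ξ n‖) (fun _ => 0) atTop Q) :
    ∃ v, ‖v‖ = 1 ∧ ∀ g, T g v = v := by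
  obtain ⟨F, hF, π, hπ⟩ := exists_monoidHom_of_contraction T hmul hT
  have hclosed : IsClosed (F : Set E) := by
    convert! isClosed_eq (T 1).continuous continuous_id
    exact Set.ext hF
  have : CompleteSpace F := hclosed.completeSpace_coe
  have : TopologicalSpace.SeparableSpace F :=
    (TopologicalSpace.IsSeparable.of_separableSpace (F : Set E)).separableSpace
  obtain ⟨ι, ⟨e⟩⟩ := exists_linearIsometryEquiv_lp F
  have : TopologicalSpace.SeparableSpace (lp (fun _ : ι => ℂ) 2) :=
    e.surjective.denseRange.separableSpace e.continuous
  let σ : G →* (lp (fun _ : ι => ℂ) 2 ≃ₗᵢ[ℂ] lp (fun _ : ι => ℂ) 2) :=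
    MonoidHom.mk' (fun g => (e.symm.trans (π g)).trans e) (fun g h => by ext1 v; simp)
  have hσ : ∀ g v, σ g v = e (π g (e.symm v)) := fun g v => rfl
  have hlim' : ∀ Q : Set G, IsCompact Q → TendstoUniformlyOn (fun n g =>
      ‖σ g (e ⟨ξ n, (hF _).2 (hξ1 n)⟩) - e ⟨ξ n, (hF _).2 (hξ1 n)⟩‖) (fun _ => 0) atTop Q := by
    intro Q hQ
    refine (hlim Q hQ).congr (Eventually.of_forall fun n g _ => ?_)
    change _ = ‖σ g (e ⟨ξ n, (hF _).2 (hξ1 n)⟩) - e ⟨ξ n, (hF _).2 (hξ1 n)⟩‖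
    rw [hσ, ← map_sub, e.norm_map, e.symm_apply_apply, ← Submodule.norm_coe, Submodule.coe_sub, hπ]
  obtain ⟨v, hv, hfix⟩ := hG _ σ
    (fun v => e.continuous.comp (continuous_induced_rng.2
      (by simpa only [← hπ] using! hcont (e.symm v : E))))
    ⟨fun n => e ⟨ξ n, (hF _).2 (hξ1 n)⟩, fun n => by rw [e.norm_map]; exact hξ n, hlim'⟩
  refine ⟨(e.symm v : F), by rw [Submodule.norm_coe, e.symm.norm_map, hv], fun g => ?_⟩
  have := congrArg e.symm (hfix g)
  rw [hσ, e.symm_apply_apply] at this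
  rw [← hπ, this]

/-- A measurable multiplicative family of contractions of a separable Hilbert space is strongly
continuous. -/
theorem continuous_of_measurable_of_contraction [IsTopologicalGroup G] [LocallyCompactSpace G]
    [SecondCountableTopology G] [MeasurableSpace G] [BorelSpace G]
    [TopologicalSpace.SeparableSpace E] (T : G → E →L[ℂ] E)
    (hmul : ∀ g h v, T (g * h) v = T g (T h v)) (hT : ∀ g v, ‖T g v‖ ≤ ‖v‖)
    (hmeas : ∀ v w, Measurable fun g => ‖T g v - w‖) (v : E) : Continuous fun g => T g v := by
  have key : ∀ ε > 0, ∀ v, T 1 v = v → ∀ᶠ g in 𝓝 (1 : G), ‖T g v - v‖ < ε := by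
    intro ε hε v hv
    have hE : Nonempty E := ⟨v⟩
    -- Countably many such sets cover `G`, so one has positive Haar measure and its quotient set is
    -- a neighbourhood of `1`. The inverse appears because `T (g / h) v - v = T g (T h⁻¹ v - T g⁻¹
    -- v)`.
    let B : ℕ → Set G := fun n => {g | ‖T g⁻¹ v - TopologicalSpace.denseSeq E n‖ < ε / 2}
    have hB : ∀ n, MeasurableSet (B n) := fun n =>
      measurableSet_lt ((hmeas v _).comp measurable_inv) measurable_const
    have hcover : ⋃ n, B n = Set.univ := by
      refine Set.eq_univ_of_forall fun g => ?_
      obtain ⟨n, hn⟩ := (TopologicalSpace.denseRange_denseSeq E).exists_dist_lt (T g⁻¹ v)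
        (half_pos hε)
      exact Set.mem_iUnion.2 ⟨n, by rwa [dist_eq_norm] at hn⟩
    obtain ⟨n, hn⟩ : ∃ n, 0 < (Measure.haar : Measure G) (B n) := by
      by_contra! h
      have : (Measure.haar : Measure G) (⋃ n, B n) = 0 :=
        measure_iUnion_null fun n => le_antisymm (h n) zero_le
      rw [hcover] at this
      exact (isOpen_univ.measure_ne_zero _ Set.univ_nonempty) this
    filter_upwards [Measure.div_mem_nhds_one_of_haar_pos _ (B n) (hB n) hn] with x hx
    obtain ⟨g, hg, h, hh, rfl⟩ := hx
    have h1 : T (g / h) v - v = T g (T h⁻¹ v - T g⁻¹ v) := by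
      rw [map_sub, ← hmul, ← hmul, mul_inv_cancel, hv, div_eq_mul_inv]
    rw [h1]
    refine (hT _ _).trans_lt ?_
    calc ‖T h⁻¹ v - T g⁻¹ v‖ ≤ ‖T h⁻¹ v - TopologicalSpace.denseSeq E n‖
          + ‖T g⁻¹ v - TopologicalSpace.denseSeq E n‖ := by
          simpa [dist_eq_norm] using dist_triangle_right (T h⁻¹ v) (T g⁻¹ v)
            (TopologicalSpace.denseSeq E n)
      _ < ε := by
          have := Set.mem_ofPred.1 hg
          have := Set.mem_ofPred.1 hh
          linarith
  -- `T 1` need not be the identity, but replacing `v` by `T 1 v` changes nothing and makes `key`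
  -- applicable.
  have h1 : ∀ g, T g v = T g (T 1 v) := fun g => by rw [← hmul, mul_one]
  rw [continuous_iff_continuousAt]
  intro g₀
  rw [ContinuousAt, Metric.tendsto_nhds]
  intro ε hε
  have := key ε hε (T 1 v) (by rw [← hmul, one_mul])
  have hg : Tendsto (fun g => g₀⁻¹ * g) (𝓝 g₀) (𝓝 1) := by
    simpa using (continuous_const_mul g₀⁻¹).tendsto g₀
  filter_upwards [hg.eventually this] with g hg
  rw [dist_eq_norm]
  have h2 : T g v - T g₀ v = T g₀ (T (g₀⁻¹ * g) (T 1 v) - T 1 v) := by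
    rw [map_sub, ← hmul, ← hmul, ← hmul]
    simp
  rw [h2]
  exact (hT _ _).trans_lt hg

/-- Almost everywhere asymptotically invariant vectors are asymptotically invariant uniformly on
compact sets. -/
theorem tendstoUniformlyOn_of_ae_tendsto [IsTopologicalGroup G] [LocallyCompactSpace G]
    [SecondCountableTopology G] [MeasurableSpace G] [BorelSpace G]
    (T : G → E →L[ℂ] E)
    (hmul : ∀ g h v, T (g * h) v = T g (T h v)) (hT : ∀ g v, ‖T g v‖ ≤ ‖v‖)
    (hmeas : ∀ v w, Measurable fun g => ‖T g v - w‖) (ξ : ℕ → E)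
    (hξ1 : ∀ n, T 1 (ξ n) = ξ n)
    (hlim : ∀ᵐ g ∂(Measure.haar : Measure G), Tendsto (fun n => ‖T g (ξ n) - ξ n‖) atTop (𝓝 0))
    {Q : Set G} (hQ : IsCompact Q) :
    TendstoUniformlyOn (fun n g => ‖T g (ξ n) - ξ n‖) (fun _ => 0) atTop Q := by
  have hsymm : ∀ g n, ‖T g⁻¹ (ξ n) - ξ n‖ ≤ ‖T g (ξ n) - ξ n‖ := fun g n => by
    have : T g⁻¹ (ξ n) - ξ n = -T g⁻¹ (T g (ξ n) - ξ n) := by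
      rw [map_sub, ← hmul, inv_mul_cancel, hξ1]
      abel
    rw [this, norm_neg]
    exact hT _ _
  have htri : ∀ g h n, ‖T (g * h) (ξ n) - ξ n‖ ≤ ‖T g (ξ n) - ξ n‖ + ‖T h (ξ n) - ξ n‖ :=
    fun g h n => by
      have : T (g * h) (ξ n) - ξ n = (T g (ξ n) - ξ n) + T g (T h (ξ n) - ξ n) := by
        rw [map_sub, hmul]
        abel
      rw [this]
      exact (norm_add_le _ _).trans (by gcongr; exact hT _ _)
  rw [Metric.tendstoUniformlyOn_iff]
  intro ε hε
  simp only [Real.dist_eq, zero_sub, abs_neg, abs_norm]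
  -- the sets where the displacement is eventually small from the index `n` on
  have key : ∀ δ > 0, ∃ n, ∀ᶠ g in 𝓝 (1 : G), ∀ k ≥ n, ‖T g (ξ k) - ξ k‖ < δ := by
    intro δ hδ
    let B : ℕ → Set G := fun n => ⋂ k ≥ n, {g | ‖T g (ξ k) - ξ k‖ < δ / 2}
    have hB : ∀ n, MeasurableSet (B n) := fun n => MeasurableSet.iInter fun k =>
      MeasurableSet.iInter fun _ => measurableSet_lt (hmeas _ _) measurable_const
    obtain ⟨n, hn⟩ : ∃ n, 0 < (Measure.haar : Measure G) (B n) := by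
      by_contra! h
      have h0 : (Measure.haar : Measure G) (⋃ n, B n) = 0 :=
        measure_iUnion_null fun n => le_antisymm (h n) zero_le
      have h1 : (Measure.haar : Measure G) (⋃ n, B n)ᶜ = 0 := by
        rw [← mem_ae_iff]
        filter_upwards [hlim] with g hg
        obtain ⟨n, hn⟩ := eventually_atTop.1 (hg.eventually (gt_mem_nhds (half_pos hδ)))
        exact Set.mem_iUnion.2 ⟨n, Set.mem_iInter₂.2 hn⟩
      have h2 := measure_union_null h0 h1
      rw [Set.union_compl_self] at h2
      exact (isOpen_univ.measure_ne_zero _ Set.univ_nonempty) h2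
    refine ⟨n, ?_⟩
    filter_upwards [Measure.div_mem_nhds_one_of_haar_pos _ (B n) (hB n) hn] with x hx k hk
    obtain ⟨g, hg, h, hh, rfl⟩ := hx
    have h1 : ‖T g (ξ k) - ξ k‖ < δ / 2 := Set.mem_iInter₂.1 hg k hk
    have h2 : ‖T h (ξ k) - ξ k‖ < δ / 2 := Set.mem_iInter₂.1 hh k hk
    simp only [div_eq_mul_inv]
    linarith [htri g h⁻¹ k, hsymm h k]
  -- pointwise convergence holds on an open subgroup of full measure
  have hall : ∀ g, Tendsto (fun n => ‖T g (ξ n) - ξ n‖) atTop (𝓝 0) := by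
    intro g
    obtain ⟨s, hs, hsub⟩ : ∃ s ∈ ae (Measure.haar : Measure G), ∀ h ∈ s,
        Tendsto (fun n => ‖T h (ξ n) - ξ n‖) atTop (𝓝 0) := ⟨_, hlim, fun h hh => hh⟩
    -- Almost every `h` lies in `s` together with `g⁻¹ * h`, and `g = h * (g⁻¹ * h)⁻¹`.
    have h1 : ∀ᵐ h ∂(Measure.haar : Measure G), g⁻¹ * h ∈ s :=
      (measurePreserving_mul_left (Measure.haar : Measure G) g⁻¹).quasiMeasurePreserving.ae hs
    obtain ⟨h, hh1, hh2⟩ := (h1.and hs).exists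
    have h3 := (hsub _ hh2).add (hsub _ hh1)
    rw [add_zero] at h3
    refine squeeze_zero (fun _ => norm_nonneg _) (fun n => ?_) h3
    have := htri h (g⁻¹ * h)⁻¹ n
    simp only [mul_inv_rev, inv_inv, mul_inv_cancel_left] at this
    have h4 := hsymm (g⁻¹ * h) n
    simp only [mul_inv_rev, inv_inv] at h4
    linarith
  refine hQ.induction_on (p := fun Q => ∀ᶠ n in atTop, ∀ x ∈ Q, ‖T x (ξ n) - ξ n‖ < ε)
    (by simp) (fun s t hst ht => ?_) (fun s t hs ht => ?_) (fun g _ => ?_)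
  · filter_upwards [ht] with n hn x hx using hn x (hst hx)
  · filter_upwards [hs, ht] with n hn hn' x hx using hx.elim (hn x) (hn' x)
  -- Near `g`, write `x = g * (g⁻¹ * x)`: `hall` controls the first factor and `key` the second.
  · obtain ⟨n, hn⟩ := key (ε / 2) (half_pos hε)
    have hg : Tendsto (fun x => g⁻¹ * x) (𝓝 g) (𝓝 1) := by
      simpa using (continuous_const_mul g⁻¹).tendsto g
    refine ⟨_, mem_nhdsWithin_of_mem_nhds (hg.eventually hn), ?_⟩
    filter_upwards [eventually_ge_atTop n, (hall g).eventually (gt_mem_nhds (half_pos hε))]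
      with k hk hgk x hx
    have h1 := htri g (g⁻¹ * x) k
    rw [mul_inv_cancel_left] at h1
    have h2 : ‖T (g⁻¹ * x) (ξ k) - ξ k‖ < ε / 2 := hx k hk
    linarith

/-- Kazhdan's property for a measurable multiplicative family of contractions with almost
everywhere asymptotically invariant unit vectors. -/
theorem IsKazhdanGroup.exists_fixed_of_measurable (hG : IsKazhdanGroup G) [IsTopologicalGroup G]
    [LocallyCompactSpace G] [SecondCountableTopology G] [MeasurableSpace G] [BorelSpace G]
    [CompleteSpace E] [TopologicalSpace.SeparableSpace E] (T : G → E →L[ℂ] E)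
    (hmul : ∀ g h v, T (g * h) v = T g (T h v)) (hT : ∀ g v, ‖T g v‖ ≤ ‖v‖)
    (hmeas : ∀ v w, Measurable fun g => ‖T g v - w‖) (ξ : ℕ → E) (hξ : ∀ n, ‖ξ n‖ = 1)
    (hξ1 : ∀ n, T 1 (ξ n) = ξ n)
    (hlim : ∀ᵐ g ∂(Measure.haar : Measure G),
      Tendsto (fun n => ‖T g (ξ n) - ξ n‖) atTop (𝓝 0)) :
    ∃ v, ‖v‖ = 1 ∧ ∀ g, T g v = v :=
  hG.exists_fixed_of_continuous T hmul hT
    (continuous_of_measurable_of_contraction T hmul hT hmeas) ξ hξ hξ1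
    fun _ hQ => tendstoUniformlyOn_of_ae_tendsto T hmul hT hmeas ξ hξ1 hlim hQ

end

/-! ### The model space `ℓ²` -/

/-- The model Hilbert space `ℓ²(ℕ, ℂ)`. -/
abbrev SeqHilbert : Type := lp (fun _ : ℕ => ℂ) 2

namespace SeqHilbert

/-- The standard unit vectors. -/
noncomputable def unit (n : ℕ) : SeqHilbert := lp.single 2 n (1 : ℂ)

theorem hasSum_smul_unit (v : SeqHilbert) : HasSum (fun n => v n • unit n) v := by
  have h := lp.hasSum_single (E := fun _ : ℕ => ℂ) (p := 2) (by norm_num) v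
  convert! h using 2 with n
  rw [unit, ← lp.single_smul, smul_eq_mul, mul_one]

theorem stronglyMeasurable_apply {Z : Type*} [MeasurableSpace Z] {f : Z → SeqHilbert}
    (hf : StronglyMeasurable f) (n : ℕ) : Measurable fun z => f z n := by
  have h : Continuous fun v : SeqHilbert => v n := by
    have : (fun v : SeqHilbert => v n) = fun v => inner ℂ (unit n) v := by
      ext v
      rw [unit, lp.inner_single_left]
      simp
    rw [this]
    fun_prop
  exact (h.comp_stronglyMeasurable hf).measurable

instance : TopologicalSpace.SeparableSpace SeqHilbert := by
  have h : TopologicalSpace.IsSeparable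
      (closure (Submodule.span ℂ (Set.range unit) : Set SeqHilbert)) :=
    ((Set.countable_range unit).isSeparable.span (R := ℂ)).closure
  have hu : closure (Submodule.span ℂ (Set.range unit) : Set SeqHilbert) = Set.univ := by
    refine Set.eq_univ_of_forall fun v => ?_
    refine mem_closure_of_tendsto (hasSum_smul_unit v).tendsto_sum_nat
      (Eventually.of_forall fun N => ?_)
    exact Submodule.sum_mem _ fun i _ =>
      Submodule.smul_mem _ _ (Submodule.subset_span (Set.mem_range_self i))
  rw [hu] at h
  exact TopologicalSpace.isSeparable_univ_iff.1 h

/-- A map which is a series with strongly measurable terms is strongly measurable. -/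
theorem stronglyMeasurable_of_hasSum {Z : Type*} [MeasurableSpace Z] {f : Z → SeqHilbert}
    {u : ℕ → Z → SeqHilbert} (hu : ∀ n, StronglyMeasurable (u n))
    (h : ∀ z, HasSum (fun n => u n z) (f z)) : StronglyMeasurable f :=
  stronglyMeasurable_of_tendsto atTop
    (fun N => Finset.stronglyMeasurable_fun_sum (Finset.range N) fun n _ => hu n)
    (tendsto_pi_nhds.2 fun z => (h z).tendsto_sum_nat)

end SeqHilbert

/-! ### Measurable orthonormal frames and embedding of the fibres -/

namespace HilbertBundle

variable {Y : Type*} [MeasurableSpace Y] (H : HilbertBundle Y)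

/-- Sections in the module spanned by the fundamental sequence over the measurable functions. -/
inductive IsElementary : (∀ y, H.fiber y) → Prop
  | fund (n : ℕ) : IsElementary (H.fund n)
  | add (s t : ∀ y, H.fiber y) : IsElementary s → IsElementary t →
      IsElementary fun y => s y + t y
  | smul (c : Y → ℂ) (s : ∀ y, H.fiber y) : Measurable c → IsElementary s →
      IsElementary fun y => c y • s y

variable {H}

/-- The parameter space `Z` serves for sections over the groupoid `Y × G`, pulled back along the
range map. -/
theorem IsElementary.measurable_inner {s : ∀ y, H.fiber y} (hs : H.IsElementary s) {Z : Type*}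
    [MeasurableSpace Z] {r : Z → Y} (hr : Measurable r) {t : ∀ z, H.fiber (r z)}
    (ht : ∀ n, Measurable fun z => inner ℂ (H.fund n (r z)) (t z)) :
    Measurable fun z => inner ℂ (s (r z)) (t z) := by
  induction hs with
  | fund n => exact ht n
  | add s t _ _ hs ht => simpa only [inner_add_left] using! hs.add ht
  | smul c s hc _ hs =>
    simp only [inner_smul_left]
    exact (Complex.continuous_conj.measurable.comp (hc.comp hr)).mul hs

theorem IsElementary.isBorelSection {s : ∀ y, H.fiber y} (hs : H.IsElementary s) :
    H.IsBorelSection s := by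
  intro n
  have h := Complex.continuous_conj.measurable.comp
    (hs.measurable_inner measurable_id fun m => H.measurable_inner m n)
  simpa [Function.comp_def, inner_conj_symm] using h

theorem IsElementary.measurable_inner_elementary {s t : ∀ y, H.fiber y} (hs : H.IsElementary s)
    (ht : H.IsElementary t) : Measurable fun y => inner ℂ (s y) (t y) :=
  hs.measurable_inner measurable_id ht.isBorelSection

theorem IsElementary.measurable_norm {s : ∀ y, H.fiber y} (hs : H.IsElementary s) :
    Measurable fun y => ‖s y‖ := by
  simp only [@norm_eq_sqrt_re_inner ℂ]
  exact (Complex.measurable_re.comp (hs.measurable_inner_elementary hs)).sqrt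

theorem IsElementary.zero : H.IsElementary fun _ => 0 := by
  simpa using IsElementary.smul (H := H) (fun _ => 0) _ measurable_const (.fund 0)

theorem IsElementary.sum {ι : Type*} (F : Finset ι) {s : ι → ∀ y, H.fiber y}
    (hs : ∀ i ∈ F, H.IsElementary (s i)) : H.IsElementary fun y => ∑ i ∈ F, s i y := by
  classical
  induction F using Finset.induction_on with
  | empty => simpa using IsElementary.zero
  | insert a F ha ih =>
    simp only [Finset.sum_insert ha]
    exact .add _ _ (hs a (Finset.mem_insert_self a F))
      (ih fun i hi => hs i (Finset.mem_insert_of_mem hi))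

theorem IsElementary.sub {s t : ∀ y, H.fiber y} (hs : H.IsElementary s)
    (ht : H.IsElementary t) : H.IsElementary fun y => s y - t y := by
  simpa [sub_eq_add_neg] using IsElementary.add _ _ hs (.smul (fun _ => -1) _ measurable_const ht)

/-- The Gram–Schmidt coefficients are quotients of Borel functions. Where an earlier vector
vanishes, division by zero gives a harmless coefficient, so no partition of `Y` by dimension is
needed. -/
theorem isElementary_gramSchmidt (n : ℕ) :
    H.IsElementary fun y => InnerProductSpace.gramSchmidt ℂ (fun k => H.fund k y) n := by
  induction n using Nat.strong_induction_on with
  | _ n ih =>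
    simp only [InnerProductSpace.gramSchmidt_def ℂ _ n]
    refine (IsElementary.fund n).sub (.sum _ fun i hi => ?_)
    simp only [Submodule.starProjection_singleton]
    have hi := ih i (Finset.mem_Iio.1 hi)
    refine .smul _ _ ((hi.measurable_inner_elementary (.fund n)).div ?_) hi
    exact Complex.measurable_ofReal.comp (hi.measurable_norm.pow_const 2)

variable (H)

/-- The orthonormalized fundamental sequence. At each point, it consists of an orthonormal basis
and of zeros. -/
noncomputable def frame (n : ℕ) (y : Y) : H.fiber y :=
  InnerProductSpace.gramSchmidtNormed ℂ (fun k => H.fund k y) n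

theorem isElementary_frame (n : ℕ) : H.IsElementary (H.frame n) := by
  refine IsElementary.smul (fun y =>
    ((‖InnerProductSpace.gramSchmidt ℂ (fun k => H.fund k y) n‖ : ℂ))⁻¹) _ ?_
    (isElementary_gramSchmidt n)
  exact (Complex.measurable_ofReal.comp (isElementary_gramSchmidt n).measurable_norm).inv

/-- Parseval: the nonzero frame vectors form a Hilbert basis, as they span the fundamental sequence,
which is total by `separates`. The zeros add nothing to the sum. -/
theorem hasSum_norm_inner_frame (y : Y) (v : H.fiber y) :
    HasSum (fun n => ‖inner ℂ (H.frame n y) v‖ ^ 2) (‖v‖ ^ 2) := by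
  have ho := InnerProductSpace.gramSchmidtNormed_orthonormal' (𝕜 := ℂ) (fun k => H.fund k y)
  have hdense : ⊤ ≤ (Submodule.span ℂ (Set.range fun i :
      {i | InnerProductSpace.gramSchmidtNormed ℂ (fun k => H.fund k y) i ≠ 0} =>
        InnerProductSpace.gramSchmidtNormed ℂ (fun k => H.fund k y) i)).topologicalClosure := by
    rw [top_le_iff, Submodule.topologicalClosure_eq_top_iff, Submodule.eq_bot_iff]
    intro w hw
    refine H.separates y w fun n => ?_
    have hn : H.fund n y ∈ Submodule.span ℂ (Set.range fun i :
        {i | InnerProductSpace.gramSchmidtNormed ℂ (fun k => H.fund k y) i ≠ 0} =>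
          InnerProductSpace.gramSchmidtNormed ℂ (fun k => H.fund k y) i) := by
      have h1 : H.fund n y ∈ Submodule.span ℂ
          (Set.range (InnerProductSpace.gramSchmidtNormed ℂ (fun k => H.fund k y))) := by
        rw [InnerProductSpace.span_gramSchmidtNormed_range, InnerProductSpace.span_gramSchmidt]
        exact Submodule.subset_span ⟨n, rfl⟩
      refine Submodule.span_le.2 ?_ h1
      rintro _ ⟨i, rfl⟩
      by_cases hi : InnerProductSpace.gramSchmidtNormed ℂ (fun k => H.fund k y) i = 0
      · rw [hi]
        exact Submodule.zero_mem _
      · exact Submodule.subset_span ⟨⟨i, hi⟩, rfl⟩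
    exact hw _ hn
  let b := HilbertBasis.mk ho hdense
  have hb := b.hasSum_inner_mul_inner v v
  have h1 : HasSum (fun i : {i | InnerProductSpace.gramSchmidtNormed ℂ (fun k => H.fund k y) i ≠ 0}
      => ‖inner ℂ (H.frame i y) v‖ ^ 2) (‖v‖ ^ 2) := by
    have h2 := Complex.reCLM.hasSum hb
    convert! h2 using 1
    · ext i
      simp only [b, HilbertBasis.coe_mk, Complex.reCLM_apply]
      rw [← inner_conj_symm v, mul_comm, Complex.mul_conj, Complex.ofReal_re,
        Complex.normSq_eq_norm_sq]
      rfl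
    · exact (inner_self_eq_norm_sq (𝕜 := ℂ) v).symm
  refine (hasSum_subtype_iff_of_support_subset ?_).1 h1
  intro n hn h0
  refine hn ?_
  simp only
  rw [frame, h0, inner_zero_left, norm_zero]
  norm_num

theorem memℓp_inner_frame (y : Y) (v : H.fiber y) :
    Memℓp (fun n => inner ℂ (H.frame n y) v) 2 := by
  refine memℓp_gen ?_
  simpa using (H.hasSum_norm_inner_frame y v).summable

/-- The isometric embedding of the fibres in `ℓ²` given by the coefficients in the frame. -/
noncomputable def toSeq (y : Y) : H.fiber y →ₗᵢ[ℂ] SeqHilbert where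
  toFun v := ⟨fun n => inner ℂ (H.frame n y) v, H.memℓp_inner_frame y v⟩
  map_add' v w := by
    ext n
    exact inner_add_right _ _ _
  map_smul' c v := by
    ext n
    exact inner_smul_right _ _ _
  norm_map' v := by
    have h1 := lp.norm_rpow_eq_tsum (p := 2) (by norm_num)
      (⟨fun n => inner ℂ (H.frame n y) v, H.memℓp_inner_frame y v⟩ : SeqHilbert)
    have h2 := (H.hasSum_norm_inner_frame y v).tsum_eq
    simp only [ENNReal.toReal_ofNat, Real.rpow_ofNat] at h1
    rw [h2] at h1
    exact (sq_eq_sq₀ (norm_nonneg _) (norm_nonneg _)).1 h1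

theorem toSeq_apply (y : Y) (v : H.fiber y) (n : ℕ) :
    H.toSeq y v n = inner ℂ (H.frame n y) v := rfl

/-- The coisometry from `ℓ²` onto the fibres. -/
noncomputable def ofSeq (y : Y) : SeqHilbert →L[ℂ] H.fiber y :=
  ContinuousLinearMap.adjoint (H.toSeq y).toContinuousLinearMap

@[simp]
theorem ofSeq_toSeq (y : Y) (v : H.fiber y) : H.ofSeq y (H.toSeq y v) = v := by
  refine ext_inner_left ℂ fun w => ?_
  rw [ofSeq, ContinuousLinearMap.adjoint_inner_right]
  exact (H.toSeq y).inner_map_map w v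

theorem norm_ofSeq_le (y : Y) (x : SeqHilbert) : ‖H.ofSeq y x‖ ≤ ‖x‖ := by
  refine ((H.ofSeq y).le_opNorm x).trans (mul_le_of_le_one_left (norm_nonneg _) ?_)
  rw [ofSeq, LinearIsometryEquiv.norm_map]
  exact (H.toSeq y).norm_toContinuousLinearMap_le

theorem ofSeq_unit (y : Y) (n : ℕ) : H.ofSeq y (SeqHilbert.unit n) = H.frame n y := by
  refine ext_inner_right ℂ fun w => ?_
  rw [ofSeq, ContinuousLinearMap.adjoint_inner_left, SeqHilbert.unit, lp.inner_single_left]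
  simp [toSeq_apply]

variable {H}

/-- Expansion in the frame turns weak measurability in moving fibres into strong measurability in a
single space. -/
theorem stronglyMeasurable_toSeq {Z : Type*} [MeasurableSpace Z] {r : Z → Y} (hr : Measurable r)
    {t : ∀ z, H.fiber (r z)} (ht : ∀ n, Measurable fun z => inner ℂ (H.fund n (r z)) (t z)) :
    StronglyMeasurable fun z => H.toSeq (r z) (t z) :=
  SeqHilbert.stronglyMeasurable_of_hasSum
    (u := fun n z => inner ℂ (H.frame n (r z)) (t z) • SeqHilbert.unit n)
    (fun n => ((H.isElementary_frame n).measurable_inner hr ht).stronglyMeasurable.smul_const _)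
    fun z => SeqHilbert.hasSum_smul_unit (H.toSeq (r z) (t z))

theorem IsBorelSection.stronglyMeasurable {s : ∀ y, H.fiber y} (hs : H.IsBorelSection s) :
    StronglyMeasurable fun y => H.toSeq y (s y) :=
  stronglyMeasurable_toSeq measurable_id hs

theorem IsBorelSection.measurable_norm {s : ∀ y, H.fiber y} (hs : H.IsBorelSection s) :
    Measurable fun y => ‖s y‖ := by
  simpa using hs.stronglyMeasurable.norm.measurable

theorem isBorelSection_ofSeq {f : Y → SeqHilbert} (hf : StronglyMeasurable f) :
    H.IsBorelSection fun y => H.ofSeq y (f y) := by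
  intro n
  have h := (IsElementary.fund (H := H) n).isBorelSection.stronglyMeasurable.inner (𝕜 := ℂ) hf
  simp only [ofSeq, ContinuousLinearMap.adjoint_inner_right]
  exact h.measurable

end HilbertBundle

/-! ### The representation read in the model space -/

namespace GroupoidRep

variable {G Y : Type*} [Group G] [MeasurableSpace G] [MeasurableSpace Y] [MulAction G Y]
  {ν : Measure Y} {H : HilbertBundle Y} (L : GroupoidRep G ν H)

/-- The operators of the representation, read in the model space. -/
noncomputable def matrixOp (x : Y) (g : G) : SeqHilbert →L[ℂ] SeqHilbert :=
  (H.toSeq x).toContinuousLinearMap ∘L L.op x g (g⁻¹ • x) rfl ∘L H.ofSeq (g⁻¹ • x)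

theorem matrixOp_apply (x : Y) (g : G) (v : SeqHilbert) :
    L.matrixOp x g v = H.toSeq x (L.op x g (g⁻¹ • x) rfl (H.ofSeq (g⁻¹ • x) v)) := rfl

theorem matrixOp_toSeq (x : Y) (g : G) (v : H.fiber (g⁻¹ • x)) :
    L.matrixOp x g (H.toSeq (g⁻¹ • x) v) = H.toSeq x (L.op x g (g⁻¹ • x) rfl v) := by
  rw [matrixOp_apply, H.ofSeq_toSeq]

theorem norm_matrixOp_le {x : Y} {g : G} (hx : x ∈ L.U) (hy : g⁻¹ • x ∈ L.U) (v : SeqHilbert) :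
    ‖L.matrixOp x g v‖ ≤ ‖v‖ := by
  rw [matrixOp_apply, LinearIsometry.norm_map, L.isometry x g _ rfl hx hy]
  exact H.norm_ofSeq_le _ _

theorem matrixOp_mul {x : Y} {g h : G} (hx : x ∈ L.U) (hy : g⁻¹ • x ∈ L.U)
    (hz : h⁻¹ • g⁻¹ • x ∈ L.U) (v : SeqHilbert) :
    L.matrixOp x (g * h) v = L.matrixOp x g (L.matrixOp (g⁻¹ • x) h v) := by
  rw [matrixOp_apply L (g⁻¹ • x), matrixOp_toSeq, matrixOp_apply]
  -- The fibres over `(g * h)⁻¹ • x` and `h⁻¹ • g⁻¹ • x` are not definitionally equal types, so the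
  -- source is kept as a variable `z` with two equations.
  have key : ∀ z, (hz1 : z = h⁻¹ • g⁻¹ • x) → (hz2 : z = (g * h)⁻¹ • x) →
      L.op x (g * h) z hz2 (H.ofSeq z v) =
        L.op x g (g⁻¹ • x) rfl (L.op (g⁻¹ • x) h z hz1 (H.ofSeq z v)) :=
    fun z hz1 hz2 => L.mul x g _ h z rfl hz1 hz2 hx hy (hz1 ▸ hz) _
  have h1 : (g * h)⁻¹ • x = h⁻¹ • g⁻¹ • x := by rw [mul_inv_rev, mul_smul]
  have h2 : ∀ z, (hz1 : z = h⁻¹ • g⁻¹ • x) →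
      L.op (g⁻¹ • x) h z hz1 (H.ofSeq z v) =
        L.op (g⁻¹ • x) h (h⁻¹ • g⁻¹ • x) rfl (H.ofSeq (h⁻¹ • g⁻¹ • x) v) := by
    rintro z rfl
    rfl
  rw [key _ h1 rfl, h2 _ h1]

theorem matrixOp_one_toSeq {x : Y} (hx : x ∈ L.U) (v : H.fiber x) :
    L.matrixOp x 1 (H.toSeq x v) = H.toSeq x v := by
  have key : ∀ z, (hz : z = (1 : G)⁻¹ • x) → (hz' : z = x) →
      L.op x 1 z hz (H.ofSeq z (H.toSeq x v)) = v := by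
    intro z hz hz'
    subst hz'
    rw [H.ofSeq_toSeq, L.one _ hz hx]
  rw [matrixOp_apply, key _ rfl (by simp)]

variable [MeasurableInv G] [MeasurableSMul₂ G Y]

/-- `measurable_op` concerns the fundamental sections only. It extends to elementary sections, hence
to the frame, which is the image of the standard basis, and then to series. -/
theorem stronglyMeasurable_matrixOp {Z : Type*} [MeasurableSpace Z] {p : Z → Y × G}
    (hp : Measurable p) {f : Z → SeqHilbert} (hf : StronglyMeasurable f) :
    StronglyMeasurable fun z => L.matrixOp (p z).1 (p z).2 (f z) := by
  have hsrc : Measurable fun q : Y × G => q.2⁻¹ • q.1 := by fun_prop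
  have h1 : ∀ s, H.IsElementary s → StronglyMeasurable fun q : Y × G =>
      H.toSeq q.1 (L.op q.1 q.2 (q.2⁻¹ • q.1) rfl (s (q.2⁻¹ • q.1))) := by
    intro s hs
    induction hs with
    | fund n => exact H.stronglyMeasurable_toSeq measurable_fst fun m => L.measurable_op m n
    | add s t _ _ hs ht => simpa only [map_add] using! hs.add ht
    | smul c s hc _ hs =>
      simp only [map_smul]
      exact (hc.comp hsrc).stronglyMeasurable.smul hs
  refine SeqHilbert.stronglyMeasurable_of_hasSum (u := fun n z =>
    f z n • L.matrixOp (p z).1 (p z).2 (SeqHilbert.unit n)) (fun n => ?_) fun z => ?_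
  · refine (SeqHilbert.stronglyMeasurable_apply hf n).stronglyMeasurable.smul ?_
    simp only [matrixOp_apply, H.ofSeq_unit]
    exact (h1 _ (H.isElementary_frame n)).comp_measurable hp
  · simpa only [map_smul] using
      (L.matrixOp (p z).1 (p z).2).hasSum (SeqHilbert.hasSum_smul_unit (f z))

end GroupoidRep

/-! ### The integrated representation on `L²` -/

namespace GroupoidRep

variable {G Y : Type*} [Group G] [MeasurableSpace G] [MeasurableSpace Y] [MulAction G Y]
  {ν : Measure Y} {H : HilbertBundle Y} (L : GroupoidRep G ν H)

theorem ae_mem_U : ∀ᵐ x ∂ν, x ∈ L.U := mem_ae_iff.2 L.conull_U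

variable [MeasurableInv G] [MeasurableSMul₂ G Y] [SMulInvariantMeasure G Y ν]

omit [MeasurableInv G] in
theorem _root_.MeasureTheory.ae_smul_of_ae {p : Y → Prop} (g : G) (h : ∀ᵐ x ∂ν, p x) : ∀ᵐ x ∂ν, p (g • x) :=
  (measurePreserving_smul g ν).quasiMeasurePreserving.ae h

theorem memLp_matrixOp (g : G) (f : Lp SeqHilbert 2 ν) :
    MemLp (fun x => L.matrixOp x g (f (g⁻¹ • x))) 2 ν := by
  refine ((Lp.memLp f).comp_measurePreserving (measurePreserving_smul g⁻¹ ν)).of_le ?_ ?_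
  · exact (L.stronglyMeasurable_matrixOp (measurable_id.prodMk measurable_const)
      ((Lp.stronglyMeasurable f).comp_measurable
        (measurable_const_smul g⁻¹))).aestronglyMeasurable
  · filter_upwards [L.ae_mem_U, ae_smul_of_ae g⁻¹ L.ae_mem_U] with x hx hx'
    exact L.norm_matrixOp_le hx hx' _

/-- The operator of a group element on the square integrable sections, which are read in the
model space. -/
noncomputable def lpOp (g : G) : Lp SeqHilbert 2 ν →L[ℂ] Lp SeqHilbert 2 ν :=
  LinearMap.mkContinuous
    { toFun := fun f => (L.memLp_matrixOp g f).toLp _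
      map_add' := fun f f' => by
        rw [← MemLp.toLp_add]
        refine MemLp.toLp_congr _ _ ?_
        filter_upwards [ae_smul_of_ae g⁻¹ (Lp.coeFn_add f f')] with x hx
        rw [hx, Pi.add_apply, map_add, Pi.add_apply]
      map_smul' := fun c f => by
        rw [RingHom.id_apply, ← MemLp.toLp_const_smul]
        refine MemLp.toLp_congr _ _ ?_
        filter_upwards [ae_smul_of_ae g⁻¹ (Lp.coeFn_smul c f)] with x hx
        rw [hx, Pi.smul_apply, map_smul, Pi.smul_apply] }
    1 fun f => by
      rw [one_mul]
      change ‖(L.memLp_matrixOp g f).toLp _‖ ≤ _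
      rw [Lp.norm_toLp, Lp.norm_def, ← eLpNorm_comp_measurePreserving (Lp.aestronglyMeasurable f)
        (measurePreserving_smul g⁻¹ ν)]
      refine ENNReal.toReal_mono ((Lp.memLp f).comp_measurePreserving
        (measurePreserving_smul g⁻¹ ν)).eLpNorm_ne_top (eLpNorm_mono_ae ?_)
      filter_upwards [L.ae_mem_U, ae_smul_of_ae g⁻¹ L.ae_mem_U] with x hx hx'
      exact L.norm_matrixOp_le hx hx' _

theorem coeFn_lpOp (g : G) (f : Lp SeqHilbert 2 ν) :
    L.lpOp g f =ᵐ[ν] fun x => L.matrixOp x g (f (g⁻¹ • x)) :=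
  MemLp.coeFn_toLp (L.memLp_matrixOp g f)

theorem norm_lpOp_le (g : G) (f : Lp SeqHilbert 2 ν) : ‖L.lpOp g f‖ ≤ ‖f‖ := by
  refine ((L.lpOp g).le_opNorm f).trans (mul_le_of_le_one_left (norm_nonneg _) ?_)
  exact LinearMap.mkContinuous_norm_le _ zero_le_one _

theorem lpOp_mul (g h : G) (f : Lp SeqHilbert 2 ν) :
    L.lpOp (g * h) f = L.lpOp g (L.lpOp h f) := by
  refine Lp.ext ?_
  filter_upwards [L.coeFn_lpOp (g * h) f, L.coeFn_lpOp g (L.lpOp h f),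
    ae_smul_of_ae g⁻¹ (L.coeFn_lpOp h f), L.ae_mem_U, ae_smul_of_ae g⁻¹ L.ae_mem_U,
    ae_smul_of_ae g⁻¹ (ae_smul_of_ae h⁻¹ L.ae_mem_U)] with x h1 h2 h3 hx hy hz
  rw [h1, h2, h3, L.matrixOp_mul hx hy hz, mul_inv_rev, mul_smul]

/-- The class `L.lpOp g f` is chosen separately for each `g`; this formula replaces it by a function
jointly measurable in `(x, g)`, to which Tonelli applies. -/
theorem norm_lpOp_sub_eq (g : G) (f w : Lp SeqHilbert 2 ν) :
    ‖L.lpOp g f - w‖ =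
      (eLpNorm (fun x => L.matrixOp x g (f (g⁻¹ • x)) - w x) 2 ν).toReal := by
  rw [Lp.norm_def]
  congr 1
  refine eLpNorm_congr_ae ?_
  filter_upwards [Lp.coeFn_sub (L.lpOp g f) w, L.coeFn_lpOp g f] with x h1 h2
  rw [h1, Pi.sub_apply, h2]

theorem measurable_norm_lpOp_sub [SFinite ν] (f w : Lp SeqHilbert 2 ν) :
    Measurable fun g => ‖L.lpOp g f - w‖ := by
  simp only [L.norm_lpOp_sub_eq]
  refine Measurable.ennreal_toReal ?_
  simp only [eLpNorm_eq_lintegral_rpow_enorm_toReal (p := 2) (by norm_num) (by norm_num)]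
  refine Measurable.pow_const ?_ _
  refine Measurable.lintegral_prod_left' (f := fun p : Y × G =>
    ‖L.matrixOp p.1 p.2 (f (p.2⁻¹ • p.1)) - w p.1‖ₑ ^ (2 : ENNReal).toReal) ?_
  refine Measurable.pow_const ?_ _
  refine StronglyMeasurable.enorm (StronglyMeasurable.sub
    (L.stronglyMeasurable_matrixOp measurable_id
      ((Lp.stronglyMeasurable f).comp_measurable (by fun_prop)))
    ((Lp.stronglyMeasurable w).comp_measurable measurable_fst))

end GroupoidRep

/-! ### Ergodicity and tools from integration -/

section

variable {G Y : Type*} [Group G] [TopologicalSpace G]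
    [IsTopologicalGroup G] [LocallyCompactSpace G] [SecondCountableTopology G] [MeasurableSpace G]
    [BorelSpace G] [MeasurableSpace Y] [MulAction G Y]
    [MeasurableSMul₂ G Y] {ν : Measure Y} [SFinite ν]

/-- For an ergodic action, a Borel set which is almost invariant under each group element is null
or conull. -/
theorem ae_or_ae_of_forall_ae_smul_mem_iff
    (hergodic : ∀ A : Set Y, MeasurableSet A → (∀ g : G, (fun y => g • y) ⁻¹' A = A) →
      ν A = 0 ∨ ν Aᶜ = 0) {A : Set Y} (hA : MeasurableSet A)
    (h : ∀ g : G, ∀ᵐ x ∂ν, (g⁻¹ • x ∈ A ↔ x ∈ A)) :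
    (∀ᵐ x ∂ν, x ∈ A) ∨ ∀ᵐ x ∂ν, x ∉ A := by
  let μ : Measure G := Measure.haar
  have hμ : μ Set.univ ≠ 0 := isOpen_univ.measure_ne_zero _ Set.univ_nonempty
  have hm : MeasurableSet {p : Y × G | p.2⁻¹ • p.1 ∈ A} :=
    hA.preimage (by fun_prop : Measurable fun p : Y × G => p.2⁻¹ • p.1)
  -- the strictly invariant set of points whose orbit meets the complement in a null set
  let B : Set Y := {x | μ {g | g⁻¹ • x ∉ A} = 0}
  have hB : MeasurableSet B :=
    (measurable_measure_prodMk_left hm.compl) (measurableSet_singleton 0)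
  have hBinv : ∀ g : G, (fun y => g • y) ⁻¹' B = B := by
    intro g
    ext x
    have h1 : {k : G | k⁻¹ • g • x ∉ A} = (fun k => g⁻¹ * k) ⁻¹' {k | k⁻¹ • x ∉ A} := by
      ext k
      simp [mul_smul]
    change μ {k : G | k⁻¹ • g • x ∉ A} = 0 ↔ μ {k : G | k⁻¹ • x ∉ A} = 0
    rw [h1, measure_preimage_mul]
  have hAB : ∀ᵐ x ∂ν, (x ∈ A ↔ x ∈ B) := by
    -- By Fubini, the orbit of almost every `x` stays almost entirely in `A` or almost entirely
    -- outside, according to where `x` lies.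
    have h2 : ∀ᵐ x ∂ν, ∀ᵐ g ∂μ, (g⁻¹ • x ∈ A ↔ x ∈ A) :=
      (Measure.ae_ae_comm (hm.iff (hA.preimage measurable_fst))).2 (Eventually.of_forall h)
    filter_upwards [h2] with x hx
    constructor
    · intro hxA
      change ∀ᵐ g ∂μ, g⁻¹ • x ∈ A
      filter_upwards [hx] with g hg using hg.2 hxA
    · intro hxB
      have hxB' : ∀ᵐ g ∂μ, g⁻¹ • x ∈ A := hxB
      have : (ae μ).NeBot := ae_neBot.2 fun h0 => hμ (by rw [h0]; rfl)
      obtain ⟨g, h3, h4⟩ := (hxB'.and hx).exists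
      exact h4.1 h3
  rcases hergodic B hB hBinv with h0 | h0
  · right
    have h1 : ∀ᵐ x ∂ν, x ∉ B := measure_eq_zero_iff_ae_notMem.1 h0
    filter_upwards [h1, hAB] with x hx hx' using fun hA => hx (hx'.1 hA)
  · left
    have h1 : ∀ᵐ x ∂ν, x ∈ B := mem_ae_iff.2 h0
    filter_upwards [h1, hAB] with x hx hx' using hx'.2 hx

end

/-- Almost everywhere statements for a product measure, slice by slice of the second variable. -/
theorem MeasureTheory.Measure.ae_ae_of_ae_prod_swap {α β : Type*} [MeasurableSpace α]
    [MeasurableSpace β] {μ : Measure α} {ν : Measure β} [SFinite μ] [SFinite ν]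
    {p : α × β → Prop} (h : ∀ᵐ z ∂μ.prod ν, p z) : ∀ᵐ y ∂ν, ∀ᵐ x ∂μ, p (x, y) := by
  rw [← Measure.prod_swap] at h
  exact Measure.ae_ae_of_ae_prod (ae_of_ae_map measurable_swap.aemeasurable h)

/-- Dominated convergence in `L²` of a finite measure, for functions bounded by a constant. -/
theorem MeasureTheory.tendsto_eLpNorm_two_zero_of_bounded {α F : Type*} [MeasurableSpace α]
    [NormedAddCommGroup F] {μ : Measure α} [IsFiniteMeasure μ] {u : ℕ → α → F} (C : NNReal)
    (hu : ∀ n, AEStronglyMeasurable (u n) μ) (hC : ∀ n, ∀ᵐ x ∂μ, ‖u n x‖ ≤ C)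
    (hlim : ∀ᵐ x ∂μ, Tendsto (fun n => ‖u n x‖) atTop (𝓝 0)) :
    Tendsto (fun n => eLpNorm (u n) 2 μ) atTop (𝓝 0) := by
  simp only [eLpNorm_eq_lintegral_rpow_enorm_toReal (p := 2) (by norm_num) (by norm_num),
    ENNReal.toReal_ofNat]
  have h := tendsto_lintegral_of_dominated_convergence' (μ := μ) (f := fun _ => 0)
    (F := fun n x => ‖u n x‖ₑ ^ (2 : ℝ)) (fun _ => (C : ENNReal) ^ (2 : ℝ))
    (fun n => (hu n).enorm.pow_const _) (fun n => ?_) ?_ ?_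
  · rw [lintegral_zero] at h
    simpa using h.ennrpow_const (1 / 2 : ℝ)
  · filter_upwards [hC n] with x hx
    refine ENNReal.rpow_le_rpow ?_ (by norm_num)
    rw [← ofReal_norm]
    exact ENNReal.ofReal_le_of_le_toReal (by simpa using hx)
  · rw [lintegral_const]
    exact ENNReal.mul_ne_top (by simp) (measure_ne_top _ _)
  · filter_upwards [hlim] with x hx
    have h1 : Tendsto (fun n => ‖u n x‖ₑ) atTop (𝓝 0) := by
      simp only [← ofReal_norm]
      simpa using ENNReal.tendsto_ofReal hx
    simpa using h1.ennrpow_const (2 : ℝ)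

theorem HilbertBundle.IsBorelSection.smul {Y : Type*} [MeasurableSpace Y] {H : HilbertBundle Y}
    {s : ∀ y, H.fiber y} (hs : H.IsBorelSection s) {c : Y → ℂ} (hc : Measurable c) :
    H.IsBorelSection fun y => c y • s y := by
  intro n
  simp only [inner_smul_right]
  exact hc.mul (hs n)

/-! ### From property T of the group to property T of the action -/

section

variable {G Y : Type*} [Group G] [TopologicalSpace G]
    [IsTopologicalGroup G] [LocallyCompactSpace G] [SecondCountableTopology G] [MeasurableSpace G]
    [BorelSpace G] [MeasurableSpace Y] [MulAction G Y]
    [MeasurableSMul₂ G Y] {ν : Measure Y} [IsFiniteMeasure ν]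
    [SMulInvariantMeasure G Y ν] {H : HilbertBundle Y}

/-- For an ergodic action, a nonzero square integrable section which is invariant under every
group element yields an invariant unit section. -/
theorem GroupoidRep.hasInvariantUnitSection_of_lpOp_fixed (L : GroupoidRep G ν H)
    (hergodic : ∀ A : Set Y, MeasurableSet A → (∀ g : G, (fun y => g • y) ⁻¹' A = A) →
      ν A = 0 ∨ ν Aᶜ = 0) {v : Lp SeqHilbert 2 ν} (hv0 : v ≠ 0) (hv : ∀ g, L.lpOp g v = v) :
    L.HasInvariantUnitSection := by
  let σ : ∀ x, H.fiber x := fun x => H.ofSeq x (v x)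
  have hσ : H.IsBorelSection σ := HilbertBundle.isBorelSection_ofSeq (Lp.stronglyMeasurable v)
  have hvσ : ∀ g : G, ∀ᵐ x ∂ν, v x = H.toSeq x (L.op x g (g⁻¹ • x) rfl (σ (g⁻¹ • x))) := by
    intro g
    have h := L.coeFn_lpOp g v
    rw [hv g] at h
    filter_upwards [h] with x hx using hx
  have hinv : ∀ g : G, ∀ᵐ x ∂ν, σ x = L.op x g (g⁻¹ • x) rfl (σ (g⁻¹ • x)) := by
    intro g
    filter_upwards [hvσ g] with x hx
    change H.ofSeq x (v x) = _
    rw [hx, H.ofSeq_toSeq]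
  have hnorm : ∀ g : G, ∀ᵐ x ∂ν, ‖σ (g⁻¹ • x)‖ = ‖σ x‖ := by
    intro g
    filter_upwards [hinv g, L.ae_mem_U, ae_smul_of_ae g⁻¹ L.ae_mem_U] with x hx hU hU'
    rw [hx, L.isometry x g _ rfl hU hU']
  have hA : MeasurableSet {x | ‖σ x‖ ≠ 0} :=
    hσ.measurable_norm (measurableSet_singleton (0 : ℝ)).compl
  have hpos : ∀ᵐ x ∂ν, ‖σ x‖ ≠ 0 := by
    refine (ae_or_ae_of_forall_ae_smul_mem_iff hergodic hA fun g => ?_).resolve_right fun h0 => ?_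
    · filter_upwards [hnorm g] with x hx
      rw [hx]
    -- Invariance under `1` places `v x` in the embedded fibre, `v x = H.toSeq x (σ x)`, so `v`
    -- vanishes with `σ`; a general element of `L²` could be orthogonal to the fibres.
    · refine hv0 ((Lp.eq_zero_iff_ae_eq_zero).2 ?_)
      filter_upwards [h0, hvσ 1, hinv 1] with x h1 h2 h3
      rw [← h3, norm_eq_zero.1 (not_not.1 h1), map_zero] at h2
      exact h2
  let s : ∀ x, H.fiber x := fun x => ((‖σ x‖ : ℂ))⁻¹ • σ x
  have hs : H.IsBorelSection s :=
    hσ.smul (Complex.measurable_ofReal.comp hσ.measurable_norm).inv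
  refine ⟨s, ⟨hs, ?_⟩, ?_⟩
  · filter_upwards [hpos] with x hx
    change ‖((‖σ x‖ : ℂ))⁻¹ • σ x‖ = 1
    rw [norm_smul, norm_inv, Complex.norm_real, norm_norm, inv_mul_cancel₀ hx]
  · have hsinv : ∀ g : G, ∀ᵐ x ∂ν, s x = L.op x g (g⁻¹ • x) rfl (s (g⁻¹ • x)) := by
      intro g
      filter_upwards [hinv g, hnorm g] with x hx hx'
      change ((‖σ x‖ : ℂ))⁻¹ • σ x = L.op x g _ rfl (((‖σ (g⁻¹ • x)‖ : ℂ))⁻¹ • σ (g⁻¹ • x))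
      rw [map_smul, ← hx, hx']
    -- Fubini needs this set to be measurable; the injective `toSeq` makes it the equality set of
    -- two strongly measurable maps into `ℓ²`.
    have hm : MeasurableSet {p : Y × G | s p.1 = L.op p.1 p.2 (p.2⁻¹ • p.1) rfl
        (s (p.2⁻¹ • p.1))} := by
      have h1 : StronglyMeasurable fun p : Y × G => H.toSeq p.1 (s p.1) :=
        hs.stronglyMeasurable.comp_measurable measurable_fst
      have h2 := L.stronglyMeasurable_matrixOp measurable_id
        (hs.stronglyMeasurable.comp_measurable
          (by fun_prop : Measurable fun p : Y × G => p.2⁻¹ • p.1))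
      convert! h1.measurableSet_eq_fun h2 using 3 with p
      refine Iff.trans (H.toSeq p.1).injective.eq_iff.symm (Eq.congr_right ?_)
      exact (L.matrixOp_toSeq p.1 p.2 _).symm
    exact (Measure.ae_prod_iff_ae_ae hm).2
      ((Measure.ae_ae_comm (p := fun x g => s x = L.op x g (g⁻¹ • x) rfl (s (g⁻¹ • x))) hm).2
        (Eventually.of_forall hsinv))

/-- A finite measure preserving ergodic action of a Kazhdan group has property T. -/
theorem IsKazhdanGroup.actionHasPropertyT (hG : IsKazhdanGroup G) [StandardBorelSpace Y]
    (hν : ν ≠ 0)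
    (hergodic : ∀ A : Set Y, MeasurableSet A → (∀ g : G, (fun y => g • y) ⁻¹' A = A) →
      ν A = 0 ∨ ν Aᶜ = 0) : ActionHasPropertyT G ν := by
  rintro H L ⟨s, hs, hlim⟩
  have hmem : ∀ n, MemLp (fun y => H.toSeq y (s n y)) 2 ν := fun n =>
    MemLp.of_bound (hs n).1.stronglyMeasurable.aestronglyMeasurable 1 (by
      filter_upwards [(hs n).2] with y hy
      rw [LinearIsometry.norm_map, hy])
  let f : ℕ → Lp SeqHilbert 2 ν := fun n => (hmem n).toLp _
  have hf : ∀ n, f n =ᵐ[ν] fun y => H.toSeq y (s n y) := fun n => MemLp.coeFn_toLp (hmem n)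
  -- The common `L²` norm of all unit sections, as `ν` is not normalized.
  let c : ℝ := (eLpNorm (fun _ : Y => (1 : ℝ)) 2 ν).toReal
  have hc : 0 < c := by
    refine ENNReal.toReal_pos ?_ (memLp_const 1).eLpNorm_ne_top
    rw [eLpNorm_const _ (by norm_num) hν]
    simpa using hν
  have hfc : ∀ n, ‖f n‖ = c := by
    intro n
    rw [Lp.norm_toLp]
    congr 1
    refine eLpNorm_congr_norm_ae ?_
    filter_upwards [(hs n).2] with y hy
    rw [LinearIsometry.norm_map, hy, norm_one]
  have hf1 : ∀ n, L.lpOp 1 (f n) = f n := by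
    intro n
    refine Lp.ext ?_
    filter_upwards [L.coeFn_lpOp 1 (f n), hf n, L.ae_mem_U] with x h1 h2 hx
    rw [h1, inv_one, one_smul, h2, L.matrixOp_one_toSeq hx]
  have hflim : ∀ᵐ g ∂(Measure.haar : Measure G),
      Tendsto (fun n => ‖L.lpOp g (f n) - f n‖) atTop (𝓝 0) := by
    filter_upwards [Measure.ae_ae_of_ae_prod_swap hlim] with g hg
    simp only [L.norm_lpOp_sub_eq]
    have hae : ∀ᵐ x ∂ν, ∀ n, ‖L.matrixOp x g (f n (g⁻¹ • x)) - f n x‖ =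
        L.coboundaryNorm (s n) (x, g) := by
      refine ae_all_iff.2 fun n => ?_
      filter_upwards [hf n, ae_smul_of_ae g⁻¹ (hf n)] with x h1 h2
      rw [h1, h2, L.matrixOp_toSeq, ← map_sub, LinearIsometry.norm_map, norm_sub_rev]
      rfl
    -- The bound `2` is the largest distance between two unit vectors.
    have h0 := tendsto_eLpNorm_two_zero_of_bounded (μ := ν)
      (u := fun n x => L.matrixOp x g (f n (g⁻¹ • x)) - f n x) 2
      (fun n => ((L.memLp_matrixOp g (f n)).sub (Lp.memLp (f n))).aestronglyMeasurable)
      (fun n => ?_) ?_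
    · simpa using! (ENNReal.tendsto_toReal ENNReal.zero_ne_top).comp h0
    · filter_upwards [hae, L.ae_mem_U, ae_smul_of_ae g⁻¹ L.ae_mem_U, (hs n).2,
        ae_smul_of_ae g⁻¹ (hs n).2] with x h1 hx hx' h2 h3
      rw [h1 n, GroupoidRep.coboundaryNorm]
      refine (norm_sub_le _ _).trans ?_
      rw [L.isometry x g _ rfl hx hx', h2, h3]
      norm_num
    · filter_upwards [hae, hg] with x h1 h2
      simpa only [h1] using h2
  have : Fact ((2 : ENNReal) ≠ ⊤) := ⟨by norm_num⟩
  have hnorm : ∀ w : Lp SeqHilbert 2 ν, ‖((c : ℂ))⁻¹ • w‖ = c⁻¹ * ‖w‖ := fun w => by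
    rw [norm_smul, norm_inv, Complex.norm_real, Real.norm_of_nonneg hc.le]
  obtain ⟨v, hv1, hv⟩ := hG.exists_fixed_of_measurable L.lpOp L.lpOp_mul L.norm_lpOp_le
    L.measurable_norm_lpOp_sub (fun n => ((c : ℂ))⁻¹ • f n)
    (fun n => by rw [hnorm, hfc, inv_mul_cancel₀ hc.ne'])
    (fun n => by rw [map_smul, hf1]) (by
      filter_upwards [hflim] with g hg
      simp only [map_smul, ← smul_sub, hnorm]
      simpa using hg.const_mul c⁻¹)
  exact L.hasInvariantUnitSection_of_lpOp_fixed hergodic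
    (fun h0 => by rw [h0, norm_zero] at hv1; exact zero_ne_one hv1) hv

end

/-! ### Fixed vectors and unbounded orbits -/

/-- A group of isometries of a real Hilbert space with an orbit in an open half space has a nonzero
fixed vector. -/
theorem exists_ne_zero_fixed_of_inner_orbit {G K : Type*} [Group G] [NormedAddCommGroup K]
    [InnerProductSpace ℝ K] [CompleteSpace K] (U : G → K →ₗᵢ[ℝ] K)
    (hU : ∀ g h v, U (g * h) v = U g (U h v)) {ξ : K} {δ : ℝ} (hδ : 0 < δ)
    (h : ∀ g, δ ≤ inner ℝ ξ (U g ξ)) : ∃ v : K, v ≠ 0 ∧ ∀ g, U g v = v := by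
  -- The closed convex hull of the orbit is invariant and avoids zero; its point of least norm is
  -- fixed.
  let C : Set K := closedConvexHull ℝ (Set.range fun g => U g ξ)
  have hne : C.Nonempty := ⟨U 1 ξ, subset_closedConvexHull ⟨1, rfl⟩⟩
  have hC : Convex ℝ C := convex_closedConvexHull
  have hC' : IsClosed C := isClosed_closedConvexHull
  have hhalf : C ⊆ {x | δ ≤ inner ℝ ξ x} := by
    refine closedConvexHull_min ?_ ?_ ?_
    · rintro _ ⟨g, rfl⟩
      exact h g
    · exact convex_halfSpace_ge (innerSL ℝ ξ).toLinearMap.isLinear δ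
    · exact isClosed_le continuous_const (by fun_prop)
  have hinv : ∀ g, C ⊆ U g ⁻¹' C := by
    intro g
    refine closedConvexHull_min ?_ ?_ (hC'.preimage (U g).continuous)
    · rintro _ ⟨k, rfl⟩
      exact subset_closedConvexHull ⟨g * k, hU g k ξ⟩
    · exact hC.linear_preimage (U g).toLinearMap
  obtain ⟨v, hv, hmin⟩ := exists_norm_eq_iInf_of_complete_convex hne hC'.isComplete hC 0
  have hle := (norm_eq_iInf_iff_real_inner_le_zero hC hv).1 hmin
  refine ⟨v, fun h0 => ?_, fun g => ?_⟩
  · have := hhalf hv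
    rw [Set.mem_ofPred, h0, inner_zero_right] at this
    exact hδ.not_ge this
  -- Minimality tested at `U g v` gives `‖v‖² ≤ ⟪v, U g v⟫`; as the norms agree, `U g v = v`.
  · have h1 := hle _ (hinv g hv)
    rw [zero_sub, inner_neg_left, inner_sub_right, real_inner_self_eq_norm_sq] at h1
    have h2 := norm_sub_sq_real v (U g v)
    rw [LinearIsometry.norm_map] at h2
    have h3 : ‖v - U g v‖ ^ 2 ≤ 0 := by linarith
    have h4 : ‖v - U g v‖ = 0 :=
      (pow_eq_zero_iff two_ne_zero).1 (le_antisymm h3 (sq_nonneg _))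
    exact (sub_eq_zero.1 (norm_eq_zero.1 h4)).symm

section

variable {G K : Type*} [Group G] [NormedAddCommGroup K] [InnerProductSpace ℂ K]
  [CompleteSpace K]

/-- A unit vector which is displaced by at most one by a unitary representation yields an invariant
unit vector. -/
theorem exists_fixed_of_norm_sub_le_one (π : G →* (K ≃ₗᵢ[ℂ] K)) {ξ : K} (hξ : ‖ξ‖ = 1)
    (h : ∀ g, ‖π g ξ - ξ‖ ≤ 1) : ∃ v : K, ‖v‖ = 1 ∧ ∀ g, π g v = v := by
  let := InnerProductSpace.rclikeToReal ℂ K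
  have hre : ∀ x y : K, inner ℝ x y = RCLike.re (inner ℂ x y) := fun x y => rfl
  let U : G → K →ₗᵢ[ℝ] K := fun g =>
    { toFun := π g
      map_add' := map_add _
      map_smul' := fun c x => (π g).map_smul (c : ℂ) x
      norm_map' := (π g).norm_map }
  obtain ⟨v, hv, hfix⟩ := exists_ne_zero_fixed_of_inner_orbit U
    (fun g k v => by
      change π (g * k) v = π g (π k v)
      rw [map_mul, LinearIsometryEquiv.coe_mul, Function.comp_apply])
    -- For unit vectors `‖π g ξ - ξ‖² = 2 - 2 Re ⟪ξ, π g ξ⟫`, so displacement at most one means real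
    -- part at least `1 / 2`.
    (ξ := ξ) (δ := 1 / 2) (by norm_num) (fun g => by
      have h1 := @norm_sub_sq ℂ K _ _ _ (π g ξ) ξ
      rw [LinearIsometryEquiv.norm_map, hξ, inner_re_symm] at h1
      rw [hre]
      change 1 / 2 ≤ RCLike.re (inner ℂ ξ (π g ξ))
      nlinarith [h g, norm_nonneg (π g ξ - ξ)])
  refine ⟨((‖v‖ : ℂ))⁻¹ • v, ?_, fun g => ?_⟩
  · rw [norm_smul, norm_inv, Complex.norm_real, norm_norm, inv_mul_cancel₀ (norm_ne_zero_iff.2 hv)]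
  · rw [LinearIsometryEquiv.map_smul]
    congr 1
    exact hfix g

/-- Guichardet's construction: a unitary representation of a countable group which has
asymptotically invariant unit vectors but no invariant unit vector has an unbounded cocycle with
values in a multiple of the representation. Only the displacement of the orbit is recorded. -/
theorem exists_unbounded_orbit [Countable G] (π : G →* (K ≃ₗᵢ[ℂ] K)) (ξ : ℕ → K)
    (hξ : ∀ n, ‖ξ n‖ = 1) (hlim : ∀ g, Tendsto (fun n => ‖π g (ξ n) - ξ n‖) atTop (𝓝 0))
    (hfix : ¬ ∃ v : K, ‖v‖ = 1 ∧ ∀ g, π g v = v) :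
    ∃ b : G → lp (fun _ : ℕ => K) 2, (∀ k g h, ‖b (k * g) - b (k * h)‖ = ‖b g - b h‖) ∧
      ∀ C, ∃ g, C < ‖b g - b 1‖ := by
  obtain ⟨e, he⟩ := exists_surjective_nat G
  have hex : ∀ n : ℕ, ∃ m, ∀ i ∈ Finset.range (n + 1), ‖π (e i) (ξ m) - ξ m‖ < (1 / 2) ^ n :=
    fun n => ((Finset.eventually_all _).2 fun i _ =>
      (hlim (e i)).eventually (gt_mem_nhds (by positivity))).exists
  choose m hm using hex
  let η : ℕ → K := fun n => ξ (m n)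
  -- The geometric decay of the displacements of `η n` beats the weight `n`, so `β g` is square
  -- summable. Conversely, a bound `C < n` on the orbit forces `η n` to move by at most one.
  let β : G → ℕ → K := fun g n => (n : ℂ) • (π g (η n) - η n)
  have hβ : ∀ g n, ‖β g n‖ = n * ‖π g (η n) - η n‖ := fun g n => by
    rw [norm_smul, Complex.norm_natCast]
  have hmem : ∀ g, Memℓp (β g) 2 := by
    intro g
    obtain ⟨i, rfl⟩ := he g
    refine memℓp_gen ?_
    simp only [ENNReal.toReal_ofNat, Real.rpow_ofNat]
    have hs : Summable fun n : ℕ => (n : ℝ) ^ 2 * (1 / 4 : ℝ) ^ n :=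
      summable_pow_mul_geometric_of_norm_lt_one 2 (by norm_num)
    refine hs.of_norm_bounded_eventually_nat ?_
    filter_upwards [eventually_ge_atTop i] with n hn
    rw [norm_pow, norm_norm, hβ, mul_pow]
    have h1 := (hm n i (Finset.mem_range.2 (by omega))).le
    have h2 : ((1 / 4 : ℝ)) ^ n = ((1 / 2) ^ n) ^ 2 := by
      rw [← pow_mul, mul_comm, pow_mul]
      norm_num
    rw [h2]
    gcongr
  let b : G → lp (fun _ : ℕ => K) 2 := fun g => ⟨β g, hmem g⟩
  refine ⟨b, fun k g h => ?_, fun C => ?_⟩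
  · have h1 : ∀ n, ‖(b (k * g) - b (k * h)) n‖ = ‖(b g - b h) n‖ := by
      intro n
      have h2 : ∀ g h, (b g - b h) n = (n : ℂ) • (π g (η n) - π h (η n)) := fun g h => by
        change β g n - β h n = _
        simp only [β]
        rw [← smul_sub]
        congr 1
        abel
      rw [h2, h2, map_mul, map_mul, LinearIsometryEquiv.coe_mul, LinearIsometryEquiv.coe_mul,
        Function.comp_apply, Function.comp_apply, ← map_sub, norm_smul, norm_smul, LinearIsometryEquiv.norm_map]
    rw [lp.norm_eq_tsum_rpow (by norm_num), lp.norm_eq_tsum_rpow (by norm_num)]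
    simp only [h1]
  · by_contra! hC
    refine hfix ?_
    obtain ⟨n, hn⟩ := exists_nat_gt (max C 0)
    have hn0 : (0 : ℝ) < n := (le_max_right C 0).trans_lt hn
    refine exists_fixed_of_norm_sub_le_one π (hξ (m n)) fun g => ?_
    have h1 : b 1 = 0 := by
      ext n
      change (n : ℂ) • (π 1 (η n) - η n) = 0
      simp
    have h2 := hC g
    rw [h1, sub_zero] at h2
    have h3 : ‖β g n‖ ≤ C := (lp.norm_apply_le_norm (by norm_num) (b g) n).trans h2
    rw [hβ] at h3
    have h4 := (h3.trans (le_max_left C 0)).trans hn.le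
    exact le_of_mul_le_mul_left (by rwa [mul_one]) hn0

end

/-! ### Positive semidefinite kernels and their Hilbert spaces -/

namespace Matrix

open scoped ComplexOrder Matrix

/-- The Gram matrix of a family of vectors of any size is positive semidefinite. -/
theorem posSemidef_gram_of_family {X E : Type*} [NormedAddCommGroup E] [InnerProductSpace ℂ E]
    (v : X → E) : (gram ℂ v).PosSemidef := by
  refine ⟨isHermitian_gram ℂ v, fun x => ?_⟩
  have h : (x.sum fun i xi => x.sum fun j xj => star xi * gram ℂ v i j * xj) =
      inner ℂ (x.sum fun i xi => xi • v i) (x.sum fun i xi => xi • v i) := by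
    simp only [Finsupp.sum, sum_inner, gram_apply]
    refine Finset.sum_congr rfl fun i _ => ?_
    rw [inner_sum]
    refine Finset.sum_congr rfl fun j _ => ?_
    rw [inner_smul_left, inner_smul_right, mul_assoc, mul_comm (inner ℂ (v i) (v j))]
    rfl
  rw [h, inner_self_eq_norm_sq_to_K]
  exact pow_nonneg (Complex.zero_le_real.2 (norm_nonneg (x.sum fun i xi => xi • v i))) 2

/-- An entrywise limit of positive semidefinite matrices is positive semidefinite. -/
theorem PosSemidef.of_tendsto {X : Type*} {A : ℕ → Matrix X X ℂ} {B : Matrix X X ℂ}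
    (hA : ∀ n, (A n).PosSemidef) (h : ∀ i j, Tendsto (fun n => A n i j) atTop (𝓝 (B i j))) :
    B.PosSemidef := by
  refine ⟨?_, fun x => ?_⟩
  · ext i j
    refine tendsto_nhds_unique (((continuous_star.tendsto _).comp (h j i)).congr fun n => ?_)
      (h i j)
    exact (hA n).1.apply i j
  · refine ge_of_tendsto' (f := fun n => x.sum fun i xi => x.sum fun j xj =>
      star xi * A n i j * xj) (x := atTop) ?_ fun n => (hA n).2 x
    exact tendsto_finsetSum _ fun i _ => tendsto_finsetSum _ fun j _ =>
      ((h i j).const_mul _).mul_const _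

theorem PosSemidef.of_hasSum {X : Type*} {A : ℕ → Matrix X X ℂ} {B : Matrix X X ℂ}
    (hA : ∀ n, (A n).PosSemidef) (h : ∀ i j, HasSum (fun n => A n i j) (B i j)) :
    B.PosSemidef := by
  refine .of_tendsto (A := fun N => ∑ n ∈ Finset.range N, A n) (fun N => ?_) fun i j => ?_
  · exact posSemidef_sum _ fun n _ => hA n
  · simpa only [Matrix.sum_apply] using (h i j).tendsto_sum_nat

/-- The entrywise exponential of a positive semidefinite matrix is positive semidefinite. -/
theorem PosSemidef.map_exp {X : Type*} {A : Matrix X X ℂ} (hA : A.PosSemidef) :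
    (A.map Complex.exp).PosSemidef := by
  -- Entrywise powers are covered by the Schur product theorem, and the exponential is a series in
  -- them with nonnegative coefficients.
  have hpow : ∀ n : ℕ, (A.map (· ^ n)).PosSemidef := by
    intro n
    induction n with
    | zero =>
      have h := posSemidef_gram_of_family (fun _ : X => (1 : ℂ))
      convert! h using 1
      ext i j
      simp
    | succ n ih =>
      convert! ih.hadamard hA using 1
  refine .of_hasSum (A := fun n => ((n.factorial : ℝ)⁻¹ : ℂ) • A.map (· ^ n)) (fun n => ?_) ?_
  · refine (hpow n).smul ?_
    exact_mod_cast inv_nonneg.2 (Nat.cast_nonneg (α := ℝ) n.factorial)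
  · intro i j
    have h := NormedSpace.expSeries_div_hasSum_exp (𝔸 := ℂ) (A i j)
    rw [← Complex.exp_eq_exp_ℂ] at h
    convert! h using 2 with n
    simp [div_eq_inv_mul]

/-- The Gaussian kernel of a Hilbert space is positive semidefinite. -/
theorem posSemidef_gaussian {X E : Type*} [NormedAddCommGroup E] [InnerProductSpace ℂ E]
    (b : X → E) :
    (Matrix.of fun x y => (Real.exp (-‖b x - b y‖ ^ 2) : ℂ)).PosSemidef := by
  -- Expanding `‖b x - b y‖²` splits the kernel into `exp ⟪b x, b y⟫`, `exp ⟪b y, b x⟫` and the rank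
  -- one kernel `exp (-‖b x‖²) exp (-‖b y‖²)`.
  have h1 := (posSemidef_gram_of_family b).map_exp
  have h2 := (posSemidef_gram_of_family b).transpose.map_exp
  have h3 := posSemidef_gram_of_family (fun x : X => (Real.exp (-‖b x‖ ^ 2) : ℂ))
  convert! (h1.hadamard h2).hadamard h3 using 1
  ext x y
  simp only [of_apply, hadamard_apply, map_apply, transpose_apply, gram_apply]
  rw [← Complex.exp_add, ← inner_conj_symm (b y) (b x), Complex.add_conj]
  rw [RCLike.inner_apply, Complex.conj_ofReal, ← Complex.ofReal_exp, ← Complex.ofReal_mul,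
    ← Complex.ofReal_mul, ← Real.exp_add, ← Real.exp_add, @norm_sub_sq ℂ E]
  congr 2
  simp only [RCLike.re_eq_complex_re]
  ring

/-- A positive semidefinite matrix over a countable index set is the Gram matrix of a total family
in some `ℓ²` space in `Type`. -/
theorem PosSemidef.exists_features {X : Type*} [Countable X] {M : Matrix X X ℂ}
    (hM : M.PosSemidef) : ∃ (ι : Type) (F : X → lp (fun _ : ι => ℂ) 2),
      (∀ x y, inner ℂ (F x) (F y) = M x y) ∧
      (Submodule.span ℂ (Set.range F)).topologicalClosure = ⊤ := by
  -- The scalar kernel is viewed as operator-valued on `ℂ`; the feature of `x` is the kernel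
  -- function of its reproducing kernel Hilbert space, taken at `1`.
  let A : Matrix X X (ℂ →L[ℂ] ℂ) := Matrix.of fun x y => M x y • 1
  have hA : A.PosSemidef := by
    have key := (RKHS.posSemidef_tfae (K := A)).out 0 2
    refine key.2 ⟨?_, fun v => ?_⟩
    · ext x y
      have := hM.1.apply x y
      simpa [A] using this
    · have h := hM.2 v
      have h1 := (Complex.le_def.1 h).1
      convert! h1 using 1
      rw [← RCLike.re_eq_complex_re]
      congr 1
      refine Finsupp.sum_congr fun x _ => Finsupp.sum_congr fun y _ => ?_
      rw [← hM.1.apply x y]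
      simp only [A, Matrix.of_apply, _root_.smul_apply,
        one_apply_eq_self, smul_eq_mul, RCLike.inner_apply, map_mul, RCLike.star_def]
      ring
  have : Fact A.PosSemidef := ⟨hA⟩
  let F : X → RKHS.OfKernel A := fun x => RKHS.kerFun (RKHS.OfKernel A) x 1
  have hF : ∀ x y, inner ℂ (F x) (F y) = M x y := by
    intro x y
    simp only [F]
    rw [RKHS.kerFun_inner, RKHS.kerFun_apply, RKHS.OfKernel.kernel_ofKernel]
    simp [A]
  have hdense : (Submodule.span ℂ (Set.range F)).topologicalClosure = ⊤ := by
    rw [← RKHS.kerFun_dense (RKHS.OfKernel A)]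
    congr 1
    refine le_antisymm (Submodule.span_mono ?_) (Submodule.span_le.2 ?_)
    · rintro _ ⟨x, rfl⟩
      exact ⟨x, 1, rfl⟩
    · rintro _ ⟨x, v, rfl⟩
      have : RKHS.kerFun (RKHS.OfKernel A) x v = v • F x := by
        simp only [F]
        rw [← map_smul, smul_eq_mul, mul_one]
      rw [this]
      exact Submodule.smul_mem _ _ (Submodule.subset_span ⟨x, rfl⟩)
  have hsep : TopologicalSpace.SeparableSpace (RKHS.OfKernel A) := by
    have h := ((Set.countable_range F).isSeparable.span (R := ℂ)).closure
    rw [← Submodule.topologicalClosure_coe, hdense] at h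
    exact TopologicalSpace.isSeparable_univ_iff.1 h
  obtain ⟨ι, ⟨e⟩⟩ := exists_linearIsometryEquiv_lp (RKHS.OfKernel A)
  refine ⟨ι, e ∘ F, fun x y => (e.inner_map_map (F x) (F y)).trans (hF x y), ?_⟩
  have h := DenseRange.topologicalClosure_map_submodule
    (f := (e : RKHS.OfKernel A →L[ℂ] lp (fun _ : ι => ℂ) 2)) e.surjective.denseRange hdense
  rwa [Submodule.map_span, ← Set.range_comp] at h

end Matrix

/-- Two families with the same Gram matrix, the first one total, differ by a contraction. -/
theorem exists_continuousLinearMap_of_inner_eq {X E : Type*} [NormedAddCommGroup E]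
    [InnerProductSpace ℂ E] [CompleteSpace E] {F F' : X → E}
    (hF : (Submodule.span ℂ (Set.range F)).topologicalClosure = ⊤)
    (h : ∀ x y, inner ℂ (F' x) (F' y) = inner ℂ (F x) (F y)) :
    ∃ T : E →L[ℂ] E, (∀ x, T (F x) = F' x) ∧ ∀ v, ‖T v‖ ≤ ‖v‖ := by
  let e := Finsupp.linearCombination ℂ F
  let f := Finsupp.linearCombination ℂ F'
  have hdense : DenseRange e := by
    have h1 : (Set.range e : Set E) = Submodule.span ℂ (Set.range F) := by
      rw [← Finsupp.range_linearCombination]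
      rfl
    rw [DenseRange, h1]
    exact Submodule.dense_iff_topologicalClosure_eq_top.2 hF
  -- Equal Gram matrices give corresponding combinations equal norms, so `F x ↦ F' x` is well
  -- defined on the span and extends to the closure.
  have hnorm : ∀ a, ‖f a‖ ≤ 1 * ‖e a‖ := by
    intro a
    have h1 : inner ℂ (f a) (f a) = inner ℂ (e a) (e a) := by
      simp only [e, f, Finsupp.linearCombination_apply, Finsupp.sum, sum_inner, inner_sum,
        inner_smul_left, inner_smul_right, h]
    rw [one_mul, @norm_eq_sqrt_re_inner ℂ, @norm_eq_sqrt_re_inner ℂ E _ _ _ (e a), h1]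
  refine ⟨f.extendOfNorm e, fun x => ?_, fun v => ?_⟩
  · have h1 := LinearMap.extendOfNorm_eq hdense ⟨1, hnorm⟩ (Finsupp.single x 1)
    simpa [e, f] using h1
  · simpa using LinearMap.norm_extendOfNorm_apply_le hdense 1 hnorm v

/-- A group of symmetries of the Gram matrix of a total family acts by contractions. -/
theorem exists_contractions_of_inner_invariant {G X E : Type*} [Group G] [NormedAddCommGroup E]
    [InnerProductSpace ℂ E] [CompleteSpace E] {F : X → E}
    (hF : (Submodule.span ℂ (Set.range F)).topologicalClosure = ⊤) (α : G → X → X)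
    (hα1 : ∀ x, α 1 x = x) (hα : ∀ g h x, α (g * h) x = α g (α h x))
    (h : ∀ g x y, inner ℂ (F (α g x)) (F (α g y)) = inner ℂ (F x) (F y)) :
    ∃ σ : G → E →L[ℂ] E, (∀ g x, σ g (F x) = F (α g x)) ∧ (∀ g v, ‖σ g v‖ ≤ ‖v‖) ∧
      (∀ v, σ 1 v = v) ∧ ∀ g h v, σ (g * h) v = σ g (σ h v) := by
  choose σ hσ hσ' using fun g => exists_continuousLinearMap_of_inner_eq hF (h g)
  have hdense := Submodule.dense_iff_topologicalClosure_eq_top.2 hF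
  have hext : ∀ S T : E →L[ℂ] E, (∀ x, S (F x) = T (F x)) → S = T := fun S T hST =>
    ContinuousLinearMap.ext_on hdense fun _ hv => by
      obtain ⟨x, rfl⟩ := hv
      exact hST x
  refine ⟨σ, hσ, hσ', fun v => ?_, fun g k v => ?_⟩
  · rw [hext (σ 1) (ContinuousLinearMap.id ℂ E) fun x => by rw [hσ, hα1]; rfl]
    rfl
  · rw [hext (σ (g * k)) (σ g ∘L σ k) fun x => by
      rw [hσ, ContinuousLinearMap.comp_apply, hσ, hσ, hα]]
    rfl

/-! ### A weakly vanishing representation with almost invariant vectors -/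

/-- Pointwise convergence to zero of a sequence of contractions, tested against total families. -/
theorem tendsto_inner_zero_of_total {X E : Type*} [NormedAddCommGroup E]
    [InnerProductSpace ℂ E] {F : X → E}
    (hF : (Submodule.span ℂ (Set.range F)).topologicalClosure = ⊤) {T : ℕ → E →L[ℂ] E}
    (hT : ∀ n v, ‖T n v‖ ≤ ‖v‖)
    (h : ∀ x y, Tendsto (fun n => inner ℂ (F x) (T n (F y))) atTop (𝓝 0)) (v w : E) :
    Tendsto (fun n => inner ℂ v (T n w)) atTop (𝓝 0) := by
  have hdense := Submodule.dense_iff_topologicalClosure_eq_top.2 hF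
  have hbound : ∀ v w n, ‖inner ℂ v (T n w)‖ ≤ ‖v‖ * ‖w‖ := fun v w n =>
    (norm_inner_le_norm _ _).trans (mul_le_mul_of_nonneg_left (hT n w) (norm_nonneg v))
  have happrox : ∀ v : E, ∀ ε > 0, ∃ u ∈ Submodule.span ℂ (Set.range F), ‖v - u‖ < ε := by
    intro v ε hε
    obtain ⟨u, hu, hd⟩ := hdense.exists_dist_lt v hε
    exact ⟨u, hu, by rwa [dist_eq_norm] at hd⟩
  have h1 : ∀ x, ∀ w ∈ Submodule.span ℂ (Set.range F),
      Tendsto (fun n => inner ℂ (F x) (T n w)) atTop (𝓝 0) := by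
    intro x w hw
    induction hw using Submodule.span_induction with
    | mem _ hy =>
      obtain ⟨y, rfl⟩ := hy
      exact h x y
    | zero => simp
    | add y z _ _ hy hz => simpa [inner_add_right] using hy.add hz
    | smul c y _ hy => simpa [inner_smul_right] using hy.const_mul c
  have h2 : ∀ v ∈ Submodule.span ℂ (Set.range F), ∀ w ∈ Submodule.span ℂ (Set.range F),
      Tendsto (fun n => inner ℂ v (T n w)) atTop (𝓝 0) := by
    intro v hv w hw
    induction hv using Submodule.span_induction with
    | mem _ hy =>
      obtain ⟨y, rfl⟩ := hy
      exact h1 y w hw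
    | zero => simp
    | add y z _ _ hy hz => simpa [inner_add_left] using hy.add hz
    | smul c y _ hy => simpa [inner_smul_left] using hy.mul_const _
  rw [Metric.tendsto_nhds]
  intro ε hε
  -- `v'` is chosen first because the tolerance for `w'` depends on it; each `+ 1` avoids division
  -- by zero.
  obtain ⟨v', hv', hvv⟩ := happrox v (ε / 3 / (‖w‖ + 1)) (by positivity)
  obtain ⟨w', hw', hww⟩ := happrox w (ε / 3 / (‖v'‖ + 1)) (by positivity)
  filter_upwards [(Metric.tendsto_nhds.1 (h2 v' hv' w' hw')) (ε / 3) (by positivity)] with n hn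
  rw [dist_zero_right] at hn ⊢
  have hdecomp : inner ℂ v (T n w) =
      inner ℂ (v - v') (T n w) + inner ℂ v' (T n (w - w')) + inner ℂ v' (T n w') := by
    rw [inner_sub_left, map_sub, inner_sub_right]
    ring
  have e1 : ‖inner ℂ (v - v') (T n w)‖ ≤ ε / 3 := by
    refine (hbound _ _ n).trans ?_
    rw [lt_div_iff₀ (by positivity)] at hvv
    nlinarith [norm_nonneg (v - v'), norm_nonneg w]
  have e2 : ‖inner ℂ v' (T n (w - w'))‖ ≤ ε / 3 := by
    refine (hbound _ _ n).trans ?_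
    rw [lt_div_iff₀ (by positivity)] at hww
    nlinarith [norm_nonneg (w - w'), norm_nonneg v']
  rw [hdecomp]
  refine (norm_add₃_le).trans_lt ?_
  linarith

open scoped ComplexOrder Matrix in
/-- An isometric orbit which is unbounded gives a unitary representation on an `ℓ²` space which has
asymptotically invariant unit vectors, while the group elements tend weakly to zero along a
sequence. -/
theorem exists_almost_invariant_weakly_mixing {G E : Type*} [Group G] [Countable G]
    [NormedAddCommGroup E] [InnerProductSpace ℂ E] (b : G → E)
    (hb : ∀ k g h, ‖b (k * g) - b (k * h)‖ = ‖b g - b h‖) (hb' : ∀ C, ∃ g, C < ‖b g - b 1‖) :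
    ∃ (ι : Type) (σ : G → lp (fun _ : ι => ℂ) 2 →L[ℂ] lp (fun _ : ι => ℂ) 2)
      (u : ℕ → lp (fun _ : ι => ℂ) 2) (γ : ℕ → G),
      TopologicalSpace.SeparableSpace (lp (fun _ : ι => ℂ) 2) ∧
      (∀ g v, ‖σ g v‖ ≤ ‖v‖) ∧ (∀ v, σ 1 v = v) ∧ (∀ g h v, σ (g * h) v = σ g (σ h v)) ∧
      (∀ n, ‖u n‖ = 1) ∧ (∀ g, Tendsto (fun n => ‖u n - σ g (u n)‖) atTop (𝓝 0)) ∧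
      ∀ v w, Tendsto (fun n => inner ℂ v (σ (γ n) w)) atTop (𝓝 0) := by
  classical
  -- Scaling `b` by `c k` divides the exponent of the Gaussian kernel by `k + 1`.
  let c : ℕ → ℝ := fun k => Real.sqrt (1 / ((k : ℝ) + 1))
  have hc : ∀ k, 0 < c k := fun k => Real.sqrt_pos.2 (by positivity)
  have hc2 : ∀ k, c k ^ 2 = 1 / ((k : ℝ) + 1) := fun k => Real.sq_sqrt (by positivity)
  let B : ℕ × G → E := fun x => (c x.1 : ℂ) • b x.2
  -- The Hadamard product with `D` makes different levels `k` orthogonal, so that one kernel encodes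
  -- the direct sum.
  let D : Matrix (ℕ × G) (ℕ × G) ℂ := Matrix.of fun x y => if x.1 = y.1 then 1 else 0
  have hD : D.PosSemidef := by
    convert! Matrix.posSemidef_gram_of_family (fun x : ℕ × G => SeqHilbert.unit x.1) using 1
    ext x y
    rw [Matrix.gram_apply, SeqHilbert.unit, SeqHilbert.unit, lp.inner_single_left]
    simp only [D, Matrix.of_apply, lp.single_apply, Pi.single_apply]
    split_ifs <;> simp
  obtain ⟨ι, F, hF, htotal⟩ := (hD.hadamard (Matrix.posSemidef_gaussian B)).exists_features
  have hB : ∀ k g h, ‖B (k, g) - B (k, h)‖ ^ 2 = ‖b g - b h‖ ^ 2 / ((k : ℝ) + 1) := by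
    intro k g h
    simp only [B]
    rw [← smul_sub, norm_smul, mul_pow, Complex.norm_real, Real.norm_of_nonneg (hc k).le, hc2]
    ring
  have hinner : ∀ k g h, inner ℂ (F (k, g)) (F (k, h)) =
      (Real.exp (-(‖b g - b h‖ ^ 2 / ((k : ℝ) + 1))) : ℂ) := by
    intro k g h
    rw [hF, Matrix.hadamard_apply]
    simp only [D, Matrix.of_apply, hB, if_true, one_mul]
  have hinner0 : ∀ k l g h, k ≠ l → inner ℂ (F (k, g)) (F (l, h)) = 0 := by
    intro k l g h hkl
    rw [hF, Matrix.hadamard_apply]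
    simp only [D, Matrix.of_apply, hkl, if_false, zero_mul]
  obtain ⟨σ, hσF, hσ, hσ1, hσm⟩ := exists_contractions_of_inner_invariant htotal
    (fun g x => (x.1, g * x.2)) (fun x => by simp) (fun g h x => by simp [mul_assoc])
    (fun g x y => by
      obtain ⟨k, x⟩ := x
      obtain ⟨l, y⟩ := y
      by_cases hkl : k = l
      · subst hkl
        simp only [hinner, hb]
      · rw [hinner0 _ _ _ _ hkl, hinner0 _ _ _ _ hkl])
  choose γ hγ using fun n : ℕ => hb' n
  have hsep : TopologicalSpace.SeparableSpace (lp (fun _ : ι => ℂ) 2) := by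
    have h := ((Set.countable_range F).isSeparable.span (R := ℂ)).closure
    rw [← Submodule.topologicalClosure_coe, htotal] at h
    exact TopologicalSpace.isSeparable_univ_iff.1 h
  have hnorm : ∀ x, ‖F x‖ = 1 := by
    rintro ⟨k, g⟩
    have h := inner_self_eq_norm_sq_to_K (𝕜 := ℂ) (F (k, g))
    rw [hinner, sub_self, norm_zero] at h
    have h1 : (1 : ℂ) = ((‖F (k, g)‖ ^ 2 : ℝ) : ℂ) := by simpa using h
    have h2 : ‖F (k, g)‖ ^ 2 = 1 := by exact_mod_cast h1.symm
    exact (pow_eq_one_iff_of_nonneg (norm_nonneg _) two_ne_zero).1 h2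
  refine ⟨ι, σ, fun k => F (k, 1), γ, hsep, hσ, hσ1, hσm, fun k => hnorm _, fun g => ?_, ?_⟩
  · have h1 : ∀ k : ℕ, ‖F (k, 1) - σ g (F (k, 1))‖ =
        Real.sqrt (2 - 2 * Real.exp (-(‖b 1 - b g‖ ^ 2 / ((k : ℝ) + 1)))) := by
      intro k
      have h2 := @norm_sub_sq ℂ _ _ _ _ (F (k, 1)) (F (k, g))
      rw [hnorm, hnorm, hinner, RCLike.re_eq_complex_re, Complex.ofReal_re] at h2
      rw [hσF, mul_one, ← Real.sqrt_sq (norm_nonneg (F (k, 1) - F (k, g))), h2]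
      congr 1
      ring
    simp only [h1]
    have h2 : Tendsto (fun k : ℕ => ‖b 1 - b g‖ ^ 2 / ((k : ℝ) + 1)) atTop (𝓝 0) :=
      tendsto_const_nhds.div_atTop
        (tendsto_atTop_add_const_right _ _ tendsto_natCast_atTop_atTop)
    have h3 : Continuous fun t : ℝ => Real.sqrt (2 - 2 * Real.exp (-t)) := by fun_prop
    have h4 := (h3.tendsto 0).comp h2
    simpa [Function.comp_def] using h4
  · refine tendsto_inner_zero_of_total htotal (fun n => hσ (γ n)) ?_
    rintro ⟨k, x⟩ ⟨l, y⟩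
    simp only [hσF]
    by_cases hkl : k = l
    · subst hkl
      simp only [hinner]
      have h1 : Tendsto (fun n => ‖b x - b (γ n * y)‖) atTop atTop := by
        -- `b (γ n * y)` stays at the fixed distance `‖b y - b 1‖` from `b (γ n)`, which is farther
        -- than `n` from `b 1`.
        have h2 : ∀ n : ℕ, (n : ℝ) + (-(‖b y - b 1‖ + ‖b x - b 1‖)) ≤ ‖b x - b (γ n * y)‖ := by
          intro n
          have e1 : ‖b (γ n) - b 1‖ ≤ ‖b (γ n) - b (γ n * y)‖ + ‖b (γ n * y) - b x‖
              + ‖b x - b 1‖ := by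
            have := norm_add₃_le (a := b (γ n) - b (γ n * y)) (b := b (γ n * y) - b x)
              (c := b x - b 1)
            simpa using this
          have e2 : ‖b (γ n) - b (γ n * y)‖ = ‖b y - b 1‖ := by
            have := hb (γ n) 1 y
            rw [mul_one] at this
            rw [this, norm_sub_rev]
          rw [norm_sub_rev (b x) (b (γ n * y))]
          linarith [hγ n]
        exact tendsto_atTop_mono h2
          (tendsto_atTop_add_const_right _ _ tendsto_natCast_atTop_atTop)
      have h2 : Tendsto (fun n => ‖b x - b (γ n * y)‖ ^ 2 / ((k : ℝ) + 1)) atTop atTop :=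
        ((tendsto_pow_atTop two_ne_zero).comp h1).atTop_div_const (by positivity)
      have h3 := Real.tendsto_exp_neg_atTop_nhds_zero.comp h2
      exact_mod_cast (Complex.continuous_ofReal.tendsto 0).comp h3
    · simp only [hinner0 _ _ _ _ hkl, tendsto_const_nhds]

/-- A unit section of a constant bundle cannot be invariant under contractions which tend weakly to
zero along a sequence. -/
theorem not_ae_invariant_of_tendsto_inner_zero {G Y E : Type*} [Group G] [MeasurableSpace G]
    [MeasurableSpace Y] [MulAction G Y] [MeasurableSMul₂ G Y] [NormedAddCommGroup E]
    [InnerProductSpace ℂ E] [TopologicalSpace.SeparableSpace E] {ν : Measure Y} [IsFiniteMeasure ν]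
    [SMulInvariantMeasure G Y ν] (hν : ν ≠ 0) {σ : G → E →L[ℂ] E} (hσ : ∀ g v, ‖σ g v‖ ≤ ‖v‖)
    {γ : ℕ → G} (hγ : ∀ v w, Tendsto (fun n => inner ℂ v (σ (γ n) w)) atTop (𝓝 0))
    {s : Y → E} (hs : ∀ v, Measurable fun y => ‖s y - v‖) (hs1 : ∀ᵐ y ∂ν, ‖s y‖ = 1)
    (hinv : ∀ g, ∀ᵐ y ∂ν, s y = σ g (s (g⁻¹ • y))) : False := by
  have : Nonempty E := ⟨0⟩
  let D : ℕ → E := TopologicalSpace.denseSeq E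
  -- These sets increase to `Y`. For `N` large the complement has less than half the total mass, so
  -- for any group element `A N` meets its translate in positive measure.
  let A : ℕ → Set Y := fun N => ⋃ j ∈ Finset.range N, {y | ‖s y - D j‖ < 1 / 4}
  have hA : ∀ N, MeasurableSet (A N) := fun N =>
    Finset.measurableSet_biUnion _ fun j _ => measurableSet_lt (hs _) measurable_const
  have hanti : Antitone fun N => (A N)ᶜ := fun M N hMN =>
    Set.compl_subset_compl.2 (Set.biUnion_subset_biUnion_left fun j hj =>
      Finset.mem_range.2 ((Finset.mem_range.1 hj).trans_le hMN))
  have hempty : ⋂ N, (A N)ᶜ = ∅ := by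
    rw [← Set.compl_iUnion, Set.compl_empty_iff, Set.eq_univ_iff_forall]
    intro y
    obtain ⟨j, hj⟩ := (TopologicalSpace.denseRange_denseSeq E).exists_dist_lt (s y)
      (by norm_num : (0 : ℝ) < 1 / 4)
    rw [dist_eq_norm] at hj
    exact Set.mem_iUnion.2 ⟨j + 1, Set.mem_iUnion₂.2 ⟨j, Finset.self_mem_range_succ j, hj⟩⟩
  have hlim := tendsto_measure_iInter_atTop (μ := ν)
    (fun N => (hA N).compl.nullMeasurableSet) hanti ⟨0, measure_ne_top _ _⟩
  rw [hempty, measure_empty] at hlim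
  have huniv : ν Set.univ ≠ 0 := by simpa using hν
  obtain ⟨N, hN⟩ := (hlim.eventually (gt_mem_nhds (ENNReal.half_pos huniv))).exists
  have hev : ∀ᶠ n in atTop, ∀ i ∈ Finset.range N, ∀ j ∈ Finset.range N,
      ‖inner ℂ (D i) (σ (γ n) (D j))‖ < 1 / 4 := by
    refine (Finset.eventually_all _).2 fun i _ => (Finset.eventually_all _).2 fun j _ => ?_
    have h := (hγ (D i) (D j)).norm
    rw [norm_zero] at h
    exact h.eventually (gt_mem_nhds (by norm_num))
  obtain ⟨n, hn⟩ := hev.exists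
  have hsmall : ν ((A N)ᶜ ∪ (fun y => (γ n)⁻¹ • y) ⁻¹' (A N)ᶜ) < ν Set.univ := by
    refine (measure_union_le _ _).trans_lt ?_
    rw [measure_preimage_smul]
    exact (ENNReal.add_lt_add hN hN).trans_eq (ENNReal.add_halves _)
  have hfreq : ∃ y, y ∈ A N ∧ (γ n)⁻¹ • y ∈ A N ∧ ‖s y‖ = 1 ∧ ‖s ((γ n)⁻¹ • y)‖ = 1 ∧
      s y = σ (γ n) (s ((γ n)⁻¹ • y)) := by
    by_contra! hcon
    refine hsmall.not_ge (measure_mono_ae ?_)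
    filter_upwards [hs1, ae_smul_of_ae (γ n)⁻¹ hs1, hinv (γ n)] with y h1 h2 h3 _
    by_cases hy : y ∈ A N
    · right
      intro hy'
      exact hcon y hy hy' h1 h2 h3
    · exact Or.inl hy
  obtain ⟨y, hy, hy', h1, h2, h3⟩ := hfreq
  obtain ⟨i, hi, hyi⟩ := Set.mem_iUnion₂.1 hy
  obtain ⟨j, hj, hyj⟩ := Set.mem_iUnion₂.1 hy'
  rw [Set.mem_ofPred] at hyi hyj
  set t := s ((γ n)⁻¹ • y) with ht
  have hone : ‖inner ℂ (s y) (σ (γ n) t)‖ = 1 := by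
    rw [← h3, inner_self_eq_norm_sq_to_K, h1]
    simp
  -- The three terms are bounded by `1 / 4`, `5 / 16` and `1 / 4`, with sum `13 / 16`, whereas the
  -- left side has modulus one.
  have hdecomp : inner ℂ (s y) (σ (γ n) t) = inner ℂ (s y - D i) (σ (γ n) t) +
      inner ℂ (D i) (σ (γ n) (t - D j)) + inner ℂ (D i) (σ (γ n) (D j)) := by
    rw [inner_sub_left, map_sub, inner_sub_right]
    ring
  have hDi : ‖D i‖ ≤ 5 / 4 := by
    have := norm_sub_norm_le (D i) (s y)
    rw [norm_sub_rev, h1] at this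
    linarith
  have e1 : ‖inner ℂ (s y - D i) (σ (γ n) t)‖ ≤ 1 / 4 := by
    refine (norm_inner_le_norm _ _).trans ?_
    have := hσ (γ n) t
    rw [h2] at this
    nlinarith [norm_nonneg (s y - D i)]
  have e2 : ‖inner ℂ (D i) (σ (γ n) (t - D j))‖ ≤ 5 / 16 := by
    refine (norm_inner_le_norm _ _).trans ?_
    have := (hσ (γ n) (t - D j)).trans hyj.le
    nlinarith [norm_nonneg (D i), norm_nonneg (σ (γ n) (t - D j))]
  have e3 := hn i hi j hj
  have e4 : ‖inner ℂ (s y - D i) (σ (γ n) t) + inner ℂ (D i) (σ (γ n) (t - D j)) +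
      inner ℂ (D i) (σ (γ n) (D j))‖ ≤ _ := norm_add₃_le
  rw [← hdecomp] at e4
  linarith

/-! ### Constant bundles and the converse for discrete groups -/

/-- The constant bundle over a Borel space. -/
noncomputable def HilbertBundle.const (Y : Type*) [MeasurableSpace Y] (E : Type)
    [NormedAddCommGroup E] [InnerProductSpace ℂ E] [CompleteSpace E]
    [TopologicalSpace.SeparableSpace E] : HilbertBundle Y where
  fiber _ := E
  fund n _ := TopologicalSpace.denseSeq E n
  measurable_inner _ _ := measurable_const
  separates _ _ hv := (TopologicalSpace.denseRange_denseSeq E).eq_zero_of_inner_right ℂ hv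

theorem HilbertBundle.IsBorelSection.measurable_norm_sub_const {Y : Type*} [MeasurableSpace Y]
    {E : Type} [NormedAddCommGroup E] [InnerProductSpace ℂ E] [CompleteSpace E]
    [TopologicalSpace.SeparableSpace E] {s : Y → E}
    (hs : (HilbertBundle.const Y E).IsBorelSection s) (v : E) :
    Measurable fun y => ‖s y - v‖ := by
  have h : (HilbertBundle.const Y E).IsBorelSection fun y => (s y - v : E) := fun n => by
    have h1 : ∀ y, inner ℂ ((HilbertBundle.const Y E).fund n y) (s y - v : E) =
        inner ℂ ((HilbertBundle.const Y E).fund n y) (s y) -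
          inner ℂ (TopologicalSpace.denseSeq E n) v := fun y => inner_sub_right _ (s y) v
    simp only [h1]
    exact (hs n).sub measurable_const
  exact h.measurable_norm

/-- A representation of a countable group by unitary operators, as a representation of the groupoid
of an action in a constant bundle. -/
noncomputable def GroupoidRep.const {G Y : Type*} [Group G] [Countable G] [MeasurableSpace G]
    [MeasurableSingletonClass G] [MeasurableSpace Y] [MulAction G Y] (ν : Measure Y) {E : Type}
    [NormedAddCommGroup E] [InnerProductSpace ℂ E] [CompleteSpace E]
    [TopologicalSpace.SeparableSpace E] (σ : G → E →L[ℂ] E) (hσ : ∀ g v, ‖σ g v‖ ≤ ‖v‖)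
    (h1 : ∀ v, σ 1 v = v) (hmul : ∀ g h v, σ (g * h) v = σ g (σ h v)) :
    GroupoidRep G ν (HilbertBundle.const Y E) where
  op _ g _ _ := σ g
  measurable_op m n := (measurable_of_countable fun g : G =>
    (inner ℂ (TopologicalSpace.denseSeq E m) (σ g (TopologicalSpace.denseSeq E n)) : ℂ)).comp
      measurable_snd
  U := Set.univ
  measurableSet_U := MeasurableSet.univ
  conull_U := by simp
  isometry _ g _ _ _ _ (v : E) := by
    refine le_antisymm (hσ g v) ?_
    have h := hσ g⁻¹ (σ g v)
    rwa [← hmul, inv_mul_cancel, h1] at h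
  one _ _ _ v := h1 v
  mul _ g _ k _ _ _ _ _ _ _ v := hmul g k v

/-- If a finite measure preserving action of a countable discrete group has property T, then so does
the group. -/
theorem ActionHasPropertyT.isKazhdanGroup {G Y : Type*} [Group G] [TopologicalSpace G]
    [IsTopologicalGroup G] [LocallyCompactSpace G] [SecondCountableTopology G]
    [MeasurableSpace G] [BorelSpace G] [Countable G] [DiscreteTopology G] [MeasurableSpace Y]
    [MulAction G Y] [MeasurableSMul₂ G Y] {ν : Measure Y} [IsFiniteMeasure ν]
    [SMulInvariantMeasure G Y ν] (hν : ν ≠ 0) (hT : ActionHasPropertyT G ν) :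
    IsKazhdanGroup G := by
  intro K _ _ _ _ π _ hξ
  obtain ⟨ξ, hξ1, hξ⟩ := hξ
  by_contra hfix
  obtain ⟨b, hb, hb'⟩ := exists_unbounded_orbit π ξ hξ1
    (fun g => (hξ {g} isCompact_singleton).tendsto_at (Set.mem_singleton g)) hfix
  obtain ⟨ι, σ, u, γ, _, hσ, hσ1, hσm, hu, hulim, hγ⟩ :=
    exists_almost_invariant_weakly_mixing b hb hb'
  obtain ⟨s, ⟨hs, hs1⟩, hinv⟩ := hT _ (GroupoidRep.const ν σ hσ hσ1 hσm)
    ⟨fun n _ => u n, fun n => ⟨fun m =>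
        (measurable_const : Measurable fun _ : Y =>
          (inner ℂ (TopologicalSpace.denseSeq _ m) (u n) : ℂ)), Eventually.of_forall fun _ => hu n⟩,
      Eventually.of_forall fun p => hulim p.2⟩
  refine not_ae_invariant_of_tendsto_inner_zero hν hσ hγ (s := s)
    hs.measurable_norm_sub_const hs1 fun g => ?_
  have h := Measure.ae_ae_of_ae_prod_swap hinv
  -- In a discrete group singletons have positive Haar measure, so a property of almost every `g`
  -- holds for every `g`.
  by_contra hg
  have h0 : (Measure.haar : Measure G) {g} = 0 :=
    measure_mono_null (Set.singleton_subset_iff.2 hg) h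
  exact (isOpen_discrete {g}).measure_ne_zero _ (Set.singleton_nonempty g) h0

theorem corollary5 {G Y : Type*} [Group G] [TopologicalSpace G] [IsTopologicalGroup G]
    [T2Space G] [LocallyCompactSpace G] [SecondCountableTopology G] [MeasurableSpace G]
    [BorelSpace G] [MeasurableSpace Y] [StandardBorelSpace Y] [MulAction G Y]
    [MeasurableSMul₂ G Y] (ν : Measure Y) [IsFiniteMeasure ν] (hν : ν ≠ 0)
    [SMulInvariantMeasure G Y ν]
    (hergodic : ∀ A : Set Y, MeasurableSet A → (∀ g : G, (fun y => g • y) ⁻¹' A = A) →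
      ν A = 0 ∨ ν Aᶜ = 0) :
    (IsKazhdanGroup G → ActionHasPropertyT G ν) ∧
      (Countable G → DiscreteTopology G → ActionHasPropertyT G ν → IsKazhdanGroup G) :=
  ⟨fun hG => hG.actionHasPropertyT hν hergodic, fun _ _ hT => hT.isKazhdanGroup hν⟩
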